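/- Let $A$ be a finite alphabet. A substitution $\sigma$ on $A$ assigns to each letter a nonempty word over $A$; it is extended to words by concatenation. Suppose $\sigma$ is of $n\ge 1$ primitive components: there are sets $\emptyset=A_0\subsetneq A_1\subsetneq\dots\subsetneq A_n=A$ such that $\sigma(a)$ is a word over $A_i$ whenever $a\in A_i$ and $1\le i\le n$, and there is an integer $k\ge1$ such that for all $1\le i\le n$, $a\in A_i\setminus A_{i-1}$ and $b\in A_i$, the letter $b$ occurs in $\sigma^k(a)$. Let $\sigma_i$ be the restriction of $\sigma$ to $A_i$. For a substitution $\tau$ on an alphabet $B$, let $M_\tau$ be the matrix indexed by $B\times B$ whose $(a,b)$-entry is the number of occurrences of $b$ in $\tau(a)$, and, for $m\ge1$, let $\mathcal L_m(\tau)$ be the set of words of length $m$ that are factors of some $\tau^k(a)$ with $a\in B$, $k\ge 1$. The substitution $\tau^{(m)}$ on the alphabet $\mathcal L_m(\tau)$ maps $u=u_1\dots u_m$ to the sequence of the words of length $m$ that start at the positions $1,2,\dots,|\tau(u_1)|$ of $\tau(u)$. Set $\mathcal L_m(\sigma_0)=\emptyset$ and $\mathcal B_m(j)=\{u\in\mathcal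 L_m(\sigma_{j+1}) : u_1\in A_j\}$ for $0\le j<n$. Let $\theta_i$ be the dominant eigenvalue of the block $Q_i$ of $M_\sigma$ indexed by $(A_i\setminus A_{i-1})\times(A_i\setminus A_{i-1})$, that is, the eigenvalue that is strictly larger than the modulus of every other eigenvalue. Let $\lambda_i=\max_{1\le j\le i}\theta_j$ for $1\le i\le n$, and $\lambda_0=0$. Let $m\ge1$ and $1\le i\le n$, and suppose $\theta_i>1$. (1) If $\theta_i>\lambda_{i-1}$, then there are a right eigenvector $\alpha$ and a left eigenvector $\beta$ of $M_{\sigma_i^{(m)}}$ corresponding to $\theta_i$ such that $\beta\alpha=1$, $\alpha_u=0$ for $u\in\mathcal B_m(i-1)$, $\alpha_u>0$ for $u\in\mathcal L_m(\sigma_i)\setminus\mathcal B_m(i-1)$, $\beta_v>0$ for all $v\in\mathcal L_m(\sigma_i)$, and for any $u\in\mathcal L_m(\sigma_i)\setminus\mathcal B_m(i-1)$ and any $v\in\mathcal L_m(\sigma_i)$, $$\lim_{k\to\infty}\left(\theta_i^{-k}M_{\sigma^{(m)}}^k\right)_{u,v}=\alpha_u\beta_v>0.$$ (2) If $\theta_i\le\lambda_{i-1}$,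 put $I=\{1\le i_0<i : \theta_{i_1}<\theta_i \text{ for every integer } i_1 \text{ with } i_0\le i_1<i\}$, and let $i'=i$ if $I=\emptyset$ and $i'=\min I$ otherwise. Then there are $\gamma_u>0$ for $u\in\mathcal L_m(\sigma_i)\setminus\mathcal B_m(i-1)$ and $\delta_v>0$ for $v\in\mathcal L_m(\sigma_i)\setminus\mathcal L_m(\sigma_{i'-1})$ such that for any $u\in\mathcal L_m(\sigma_i)\setminus\mathcal B_m(i-1)$ and any $v\in\mathcal L_m(\sigma_i)$, $$\lim_{k\to\infty}\left(\theta_i^{-k}M_{\sigma^{(m)}}^k\right)_{u,v}=\begin{cases}\infty & \text{if } v\in\mathcal L_m(\sigma_{i'-1}),\\ \gamma_u\delta_v & \text{otherwise.}\end{cases}$$ -/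

import Mathlib

open Filter Topology

/-- A substitution on `A`: a map from letters to nonempty words. -/
structure Substitution (A : Type*) where
  toFun : A → List A
  ne_nil : ∀ a, toFun a ≠ []

namespace Substitution

variable {A : Type*}

/-- The extension of `σ` to words by concatenation. -/
def onWord (σ : Substitution A) (w : List A) : List A := w.flatMap σ.toFun

/-- The word `σ^k(a)`. -/
def iter (σ : Substitution A) (k : ℕ) (a : A) : List A := σ.onWord^[k] [a]

/-- The incidence matrix: the `(a, b)`-entry is the number of occurrences of `b` in `σ(a)`. -/
def incidence [DecidableEq A] (σ : Substitution A) : Matrix A A ℝ :=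
  Matrix.of fun a b => ((σ.toFun a).count b : ℝ)

/-- Words of length `m` that are factors of some `σ^n(a)` with `n ≥ 1` and `a ∈ B`.
If `σ` maps `B` into words over `B`, this is `L_m` of the restriction of `σ` to `B`;
for `B = Finset.univ` it is `L_m(σ)`. -/
def lang (σ : Substitution A) (B : Finset A) (m : ℕ) : Set (List A) :=
  {w | w.length = m ∧ ∃ n, 1 ≤ n ∧ ∃ a ∈ B, w <:+: σ.iter n a}

theorem finite_lang [Finite A] (σ : Substitution A) (B : Finset A) (m : ℕ) :
    (σ.lang B m).Finite :=
  (List.finite_length_eq A m).subset fun _ hw => hw.1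

noncomputable instance [Finite A] (σ : Substitution A) (B : Finset A) (m : ℕ) :
    Fintype (σ.lang B m) :=
  (σ.finite_lang B m).fintype

theorem length_le_onWord (σ : Substitution A) (w : List A) :
    w.length ≤ (σ.onWord w).length := by
  induction w with
  | nil => simp
  | cons a w ih =>
    have := List.length_pos_of_ne_nil (σ.ne_nil a)
    simp only [onWord, List.flatMap_cons, List.length_append, List.length_cons] at ih ⊢
    omega

theorem onWord_infix (σ : Substitution A) {u w : List A} (h : u <:+: w) :
    σ.onWord u <:+: σ.onWord w := by
  obtain ⟨s, t, rfl⟩ := h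
  exact ⟨σ.onWord s, σ.onWord t, by simp [onWord]⟩

theorem ne_nil_of_mem_lang (σ : Substitution A) {B : Finset A} {m : ℕ} (hm : 1 ≤ m)
    {u : List A} (hu : u ∈ σ.lang B m) : u ≠ [] := by
  rintro rfl
  have := hu.1
  simp at this
  omega

theorem window_mem_lang (σ : Substitution A) {B : Finset A} {m : ℕ} (hm : 1 ≤ m)
    {u : List A} (hu : u ∈ σ.lang B m) {j : ℕ}
    (hj : j < (σ.toFun (u.head (σ.ne_nil_of_mem_lang hm hu))).length) :
    ((σ.onWord u).drop j).take m ∈ σ.lang B m := by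
  have hne := σ.ne_nil_of_mem_lang hm hu
  obtain ⟨hlen, n, hn, a, ha, hinf⟩ := hu
  refine ⟨?_, n + 1, by omega, a, ha, ?_⟩
  · cases u with
    | nil => exact absurd rfl hne
    | cons b t =>
      have := σ.length_le_onWord t
      simp only [List.head_cons, onWord, List.flatMap_cons, List.length_take,
        List.length_drop, List.length_append] at hj this ⊢
      rw [List.length_cons] at hlen
      omega
  · have h1 : σ.iter (n + 1) a = σ.onWord (σ.iter n a) := by
      simp [iter, Function.iterate_succ_apply']
    rw [h1]
    exact ((List.take_prefix _ _).isInfix.trans (List.drop_suffix _ _).isInfix).trans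
      (σ.onWord_infix hinf)

/-- The auxiliary substitution `σ^{(m)}` on words of length `m`: the word `u` is sent to the
sequence of the length-`m` windows of `σ(u)` that start at the positions `1, …, |σ(u_1)|`.
With `B = Finset.univ` this is `σ^{(m)}` on `L_m(σ)`; with `B` a set of letters preserved by `σ`
it is the auxiliary substitution of the restriction of `σ` to `B`. -/
def aux (σ : Substitution A) (B : Finset A) (m : ℕ) (hm : 1 ≤ m) :
    Substitution (σ.lang B m) where
  toFun u := List.ofFn
    fun j : Fin (σ.toFun (u.1.head (σ.ne_nil_of_mem_lang hm u.2))).length =>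
      (⟨((σ.onWord u.1).drop j).take m, σ.window_mem_lang hm u.2 j.2⟩ : σ.lang B m)
  ne_nil u := by
    simpa [List.ofFn_eq_nil_iff] using σ.ne_nil _

/-- The inclusion of the words over a subalphabet into `L_m(σ)`. -/
def incl [Fintype A] (σ : Substitution A) {B : Finset A} {m : ℕ} (u : σ.lang B m) :
    σ.lang Finset.univ m :=
  ⟨u.1, u.2.1, by
    obtain ⟨n, hn, a, _, h⟩ := u.2.2
    exact ⟨n, hn, a, Finset.mem_univ a, h⟩⟩

/-- `σ` is of `n` primitive components, witnessed by `∅ = F 0 ⊊ F 1 ⊊ ⋯ ⊊ F n = A`. -/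
structure IsOfPrimitiveComponents [Fintype A] (σ : Substitution A) (n : ℕ)
    (F : ℕ → Finset A) : Prop where
  zero : F 0 = ∅
  top : F n = Finset.univ
  ssubset : ∀ i < n, F i ⊂ F (i + 1)
  closed : ∀ i, 1 ≤ i → i ≤ n → ∀ a ∈ F i, ∀ b ∈ σ.toFun a, b ∈ F i
  primitive : ∃ k, 1 ≤ k ∧ ∀ i, 1 ≤ i → i ≤ n →
    ∀ a ∈ F i, a ∉ F (i - 1) → ∀ b ∈ F i, b ∈ σ.iter k a

end Substitution

/-- `θ` is an eigenvalue of `M`, and every other complex eigenvalue has modulus `< θ`. -/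
def IsDominantEigenvalue {ι : Type*} [Fintype ι] [DecidableEq ι] (M : Matrix ι ι ℝ)
    (θ : ℝ) : Prop :=
  (θ : ℂ) ∈ spectrum ℂ (M.map Complex.ofReal) ∧
    ∀ η ∈ spectrum ℂ (M.map Complex.ofReal), η ≠ (θ : ℂ) → ‖η‖ < θ

theorem IsDominantEigenvalue.unique {ι : Type*} [Fintype ι] [DecidableEq ι]
    {M : Matrix ι ι ℝ} {θ θ' : ℝ} (h : IsDominantEigenvalue M θ)
    (h' : IsDominantEigenvalue M θ') : θ = θ' := by
  by_contra hne
  have h1 := h.2 _ h'.1 (fun e => hne (Complex.ofReal_injective e).symm)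
  have h2 := h'.2 _ h.1 (fun e => hne (Complex.ofReal_injective e))
  rw [Complex.norm_real, Real.norm_eq_abs] at h1 h2
  linarith [le_abs_self θ, le_abs_self θ']

open Classical in
/-- The dominant eigenvalue of `M` (unique if there is one; `0` if there is none, which never
happens for primitive matrices). -/
noncomputable def dominantEigenvalue {ι : Type*} [Fintype ι] [DecidableEq ι]
    (M : Matrix ι ι ℝ) : ℝ :=
  if h : ∃ θ, IsDominantEigenvalue M θ then h.choose else 0

namespace Substitution

variable {A : Type*} [DecidableEq A]

/-- The diagonal block `Q_i` of the incidence matrix, indexed by `F i \ F (i - 1)`. -/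
def diagBlock (σ : Substitution A) (F : ℕ → Finset A) (i : ℕ) :
    Matrix ↥(F i \ F (i - 1)) ↥(F i \ F (i - 1)) ℝ :=
  σ.incidence.submatrix Subtype.val Subtype.val

/-- `θ_i`, the dominant eigenvalue of `Q_i`. -/
noncomputable def theta (σ : Substitution A) (F : ℕ → Finset A) (i : ℕ) : ℝ :=
  dominantEigenvalue (σ.diagBlock F i)

/-- `λ_i = max_{1 ≤ j ≤ i} θ_j`; the empty maximum `λ_0` is `0`. -/
noncomputable def lam (σ : Substitution A) (F : ℕ → Finset A) (i : ℕ) : ℝ :=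
  sSup (σ.theta F '' Set.Icc 1 i)

/-- `𝓑_m(j)`: the words in `L_m(σ_{j+1})` whose first letter is in `F j`. -/
def bWords (σ : Substitution A) (F : ℕ → Finset A) (m j : ℕ) : Set (List A) :=
  {u | u ∈ σ.lang (F (j + 1)) m ∧ ∃ a ∈ F j, u.head? = some a}

/-- The set `I` of the `1 ≤ i₀ < i` such that `θ_{i₁} < θ_i` whenever `i₀ ≤ i₁ < i`. -/
def indexSet (σ : Substitution A) (F : ℕ → Finset A) (i : ℕ) : Set ℕ :=
  {i₀ | 1 ≤ i₀ ∧ i₀ < i ∧ ∀ i₁, i₀ ≤ i₁ → i₁ < i → σ.theta F i₁ < σ.theta F i}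

open Classical in
/-- `i'`, which is `i` if `I` is empty and `min I` otherwise. -/
noncomputable def iPrime (σ : Substitution A) (F : ℕ → Finset A) (i : ℕ) : ℕ :=
  if σ.indexSet F i = ∅ then i else sInf (σ.indexSet F i)

end Substitution

/-!
The words of `L_m(σ_i)` fall into two groups, according to whether their first letter is of level
`i` (in `F i \ F (i - 1)`) or lower. Words of the second kind never lead back to the first, so with
`N` the matrix of `σ_i^{(m)}` everything rests on three growth rates.

*The words that start at level `i`.* Their block of `N` is primitive, because each word of
`L_m(σ_i)` occurs in `σ^k(a)` for all large `k` and all `a` of level `i`. The windows starting in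
`σ(u_1)` have the letters of `σ(u_1)` as first letters, so the Perron–Frobenius eigenvector of
`Q_i`, read at the first letters, is an eigenvector of this block, again with eigenvalue `θ_i`
(`exists_tendsto_pow_top`). Perron–Frobenius theory for primitive matrices is developed as far as
needed: a maximality argument gives a positive eigenvector, and normalising by it turns the matrix
into a stochastic one, whose powers converge because the oscillation of their columns contracts.

*The words outside `L_m(σ_s)` that start at a lower level*, where the levels strictly between `s`
and `i` have eigenvalues below `θ_i`. All windows of `σ^k(u)` starting in `σ^k(u_1)` with
`u_1 ∈ F s` belong to `L_m(σ_s)`, apart from at most `m` of them, that stick out of `σ^k(u_1)`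
(`sum_aux_incidence_pow_le`). Going up level by level, the number of windows outside `L_m(σ_s)` is
bounded by `C μ ^ k` with `μ < θ_i` (`exists_sum_pow_le_geometric`); this is where `θ_i > 1`
enters. Sorting the paths by the edge along which they leave level `i` writes the
remaining entries of `N ^ k` as a convolution of a sequence `∼ θ_i ^ k` with one of strictly smaller
growth, so their quotients by `θ_i ^ k` converge and the limits factor (`exists_tendsto_pow`). For
`s = 0` this is case (1); the factor depending on the end point is a left eigenvector since it is a
row of the limit.

*The words of `L_m(σ_s)` for `s = i' - 1`* in case (2). Then `θ_s ≥ θ_i`, both factors of the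
convolution grow at least like `θ_i ^ k`, and the sum over the exit time supplies a further factor
`k` (`tendsto_atTop_pow`).
-/

/-! ### Perron–Frobenius theory of primitive matrices -/

namespace Matrix

theorem exists_pos_forall_le_of_finite {κ : Type*} [Finite κ] {f : κ → ℝ} (hf : ∀ i, 0 < f i) :
    ∃ ε > 0, ∀ i, ε ≤ f i := by
  cases isEmpty_or_nonempty κ with
  | inl h => exact ⟨1, one_pos, fun i => h.elim i⟩
  | inr h =>
    obtain ⟨i₀, hi₀⟩ := Finite.exists_min f
    exact ⟨f i₀, hf i₀, hi₀⟩

theorem mulVec_pos_of_pos {ι : Type*} [Fintype ι] {P : Matrix ι ι ℝ}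
    (hP : ∀ i j, 0 < P i j) {d : ι → ℝ} (hd : ∀ i, 0 ≤ d i) (hd0 : d ≠ 0) (i : ι) : 0 < (P *ᵥ d) i := by
  obtain ⟨j, hj⟩ := Function.ne_iff.1 hd0
  exact Finset.sum_pos' (fun j _ => mul_nonneg (hP i j).le (hd j))
    ⟨j, Finset.mem_univ j, mul_pos (hP i j) (lt_of_le_of_ne (hd j) (Ne.symm hj))⟩

variable {ι : Type*} [Fintype ι] [DecidableEq ι]

theorem pow_mulVec_of_mulVec_eq_smul {Q : Matrix ι ι ℝ} {x : ι → ℝ} {θ : ℝ}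
    (h : Q *ᵥ x = θ • x) (k : ℕ) : Q ^ k *ᵥ x = θ ^ k • x := by
  induction k with
  | zero => simp
  | succ k ih => rw [pow_succ, ← mulVec_mulVec, h, mulVec_smul, ih, smul_smul, pow_succ, mul_comm]

/-- The largest `r` for which some probability vector `x` satisfies `r x ≤ Q x` is an eigenvalue:
if `Q x - r x` were nonzero, a power of `Q` would make it positive everywhere, and `r` could be
increased. -/
theorem IsPrimitive.exists_pos_eigenvector [Nonempty ι] {Q : Matrix ι ι ℝ} (hQ : Q.IsPrimitive) :
    ∃ θ : ℝ, ∃ x : ι → ℝ, 0 < θ ∧ (∀ i, 0 < x i) ∧ Q *ᵥ x = θ • x := by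
  obtain ⟨hQ0, p, hp0, hp⟩ := hQ
  set R : ℝ := ∑ i, ∑ j, Q i j with hR
  set K : Set (ℝ × (ι → ℝ)) :=
    (Set.Icc 0 R ×ˢ stdSimplex ℝ ι) ∩ {z | ∀ i, z.1 * z.2 i ≤ (Q *ᵥ z.2) i} with hK
  have bound : ∀ (r : ℝ) (x : ι → ℝ), x ∈ stdSimplex ℝ ι → (∀ i, r * x i ≤ (Q *ᵥ x) i) →
      r ≤ R := by
    intro r x hx h
    have hx1 : ∀ j, x j ≤ 1 := fun j => by
      rw [← hx.2]
      exact Finset.single_le_sum (fun i _ => hx.1 i) (Finset.mem_univ j)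
    calc r = ∑ i, r * x i := by rw [← Finset.mul_sum, hx.2, mul_one]
      _ ≤ ∑ i, (Q *ᵥ x) i := Finset.sum_le_sum fun i _ => h i
      _ ≤ R := Finset.sum_le_sum fun i _ => Finset.sum_le_sum fun j _ =>
        mul_le_of_le_one_right (hQ0 i j) (hx1 j)
  have hKc : IsCompact K := by
    refine (isCompact_Icc.prod (isCompact_stdSimplex ℝ ι)).inter_right ?_
    simp only [Set.ofPred_forall]
    refine isClosed_iInter fun i => isClosed_le (by fun_prop) ?_
    have : Continuous fun z : ℝ × (ι → ℝ) => Q *ᵥ z.2 :=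
      continuous_const.matrix_mulVec continuous_snd
    exact (continuous_apply i).comp this
  have hR0 : 0 ≤ R := Finset.sum_nonneg fun i _ => Finset.sum_nonneg fun j _ => hQ0 i j
  have hKne : K.Nonempty := by
    obtain ⟨i₀⟩ := ‹Nonempty ι›
    refine ⟨(0, Pi.single i₀ 1), ⟨⟨le_rfl, hR0⟩, single_mem_stdSimplex ℝ i₀⟩, fun i => ?_⟩
    simp only [zero_mul]
    refine Finset.sum_nonneg fun j _ => mul_nonneg (hQ0 i j) ?_
    exact (single_mem_stdSimplex ℝ i₀).1 j
  obtain ⟨⟨r, x⟩, ⟨⟨⟨hr0, -⟩, hx⟩, hrx⟩, hmax⟩ :=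
    hKc.exists_isMaxOn hKne continuous_fst.continuousOn
  simp only at hr0 hx hrx
  have hx0 : x ≠ 0 := by
    rintro rfl
    simpa using hx.2
  have hy : ∀ i, 0 < (Q ^ p *ᵥ x) i := mulVec_pos_of_pos hp hx.1 hx0
  have heig : Q *ᵥ x = r • x := by
    by_contra hne
    have hd : ∀ i, 0 ≤ (Q *ᵥ x - r • x) i := fun i => by
      simpa using hrx i
    have hpos := mulVec_pos_of_pos hp hd (sub_ne_zero.2 hne)
    have hcomm : Q ^ p *ᵥ (Q *ᵥ x - r • x) = Q *ᵥ (Q ^ p *ᵥ x) - r • (Q ^ p *ᵥ x) := by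
      rw [mulVec_sub, mulVec_smul, mulVec_mulVec, mulVec_mulVec, ← pow_succ, ← pow_succ']
    rw [hcomm] at hpos
    set y := Q ^ p *ᵥ x with hydef
    obtain ⟨ε, hε, hεle⟩ := exists_pos_forall_le_of_finite
      (f := fun i => (Q *ᵥ y - r • y) i / y i) fun i => div_pos (hpos i) (hy i)
    have hs : 0 < ∑ i, y i := Finset.sum_pos (fun i _ => hy i) Finset.univ_nonempty
    have hmem : (∑ i, y i)⁻¹ • y ∈ stdSimplex ℝ ι := by
      refine ⟨fun i => mul_nonneg (inv_nonneg.2 hs.le) (hy i).le, ?_⟩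
      simp only [Pi.smul_apply, smul_eq_mul]
      rw [← Finset.mul_sum, inv_mul_cancel₀ hs.ne']
    have hle : ∀ i, (r + ε) * ((∑ i, y i)⁻¹ • y) i ≤ (Q *ᵥ ((∑ i, y i)⁻¹ • y)) i := by
      intro i
      have h1 := (le_div_iff₀ (hy i)).1 (hεle i)
      rw [mulVec_smul]
      simp only [Pi.smul_apply, smul_eq_mul, Pi.sub_apply] at h1 ⊢
      rw [mul_left_comm]
      exact mul_le_mul_of_nonneg_left (by linarith) (inv_nonneg.2 hs.le)
    have hin : (r + ε, (∑ i, y i)⁻¹ • y) ∈ K :=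
      ⟨⟨⟨by simp only; linarith, bound _ _ hmem hle⟩, hmem⟩, hle⟩
    have := hmax hin
    simp only [Set.mem_ofPred_eq] at this
    linarith
  have hpow := pow_mulVec_of_mulVec_eq_smul heig p
  have hxr : ∀ i, 0 < r ^ p * x i := fun i => by
    have := hy i
    rwa [hpow] at this
  refine ⟨r, x, lt_of_le_of_ne hr0 ?_, fun i => ?_, heig⟩
  · rintro rfl
    obtain ⟨i⟩ := ‹Nonempty ι›
    have := hxr i
    rw [zero_pow hp0.ne', zero_mul] at this
    exact lt_irrefl _ this
  · exact pos_of_mul_pos_right (hxr i) (pow_nonneg hr0 p)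

/-- The oscillation of each column of `S ^ k` is multiplied by at most `1 - ε` over any `p` steps
if all entries of `S ^ p` are at least `ε`. -/
theorem tendsto_pow_of_rowStochastic [Nonempty ι] {S : Matrix ι ι ℝ}
    (hS0 : ∀ i j, 0 ≤ S i j) (hS1 : ∀ i, ∑ j, S i j = 1) {p : ℕ}
    (hp : ∀ i j, 0 < (S ^ p) i j) (v : ι) :
    ∃ c : ℝ, 0 < c ∧ ∀ u, Tendsto (fun k : ℕ => (S ^ k) u v) atTop (𝓝 c) := by
  have hone : S *ᵥ 1 = (1 : ℝ) • 1 := by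
    ext i
    simp [mulVec, dotProduct, hS1]
  have hrow : ∀ k i, ∑ j, (S ^ k) i j = 1 := fun k i => by
    have := congrFun (pow_mulVec_of_mulVec_eq_smul hone k) i
    simpa [mulVec, dotProduct] using this
  have hnn : ∀ k i j, 0 ≤ (S ^ k) i j := fun k i j => pow_apply_nonneg hS0 k i j
  obtain ⟨ε, hε, hεle⟩ := exists_pos_forall_le_of_finite
    (f := fun z : ι × ι => (S ^ p) z.1 z.2) fun z => hp z.1 z.2
  set a : ℕ → ℝ := fun k => ⨅ u, (S ^ k) u v with ha
  set b : ℕ → ℝ := fun k => ⨆ u, (S ^ k) u v with hb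
  have hau : ∀ k u, a k ≤ (S ^ k) u v := fun k u =>
    ciInf_le (f := fun u => (S ^ k) u v) (Set.finite_range _).bddBelow u
  have hub : ∀ k u, (S ^ k) u v ≤ b k := fun k u =>
    le_ciSup (f := fun u => (S ^ k) u v) (Set.finite_range _).bddAbove u
  have hsplit : ∀ l k u, (S ^ (k + l)) u v = ∑ w, (S ^ l) u w * (S ^ k) w v := fun l k u => by
    rw [add_comm, pow_add, mul_apply]
  have hamono : Monotone a := by
    refine monotone_nat_of_le_succ fun k => le_ciInf fun u => ?_
    rw [hsplit 1 k u]
    calc a k = ∑ w, (S ^ 1) u w * a k := by rw [← Finset.sum_mul, hrow, one_mul]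
      _ ≤ _ := Finset.sum_le_sum fun w _ => mul_le_mul_of_nonneg_left (hau k w) (hnn 1 u w)
  have hbanti : Antitone b := by
    refine antitone_nat_of_succ_le fun k => ciSup_le fun u => ?_
    rw [hsplit 1 k u]
    calc ∑ w, (S ^ 1) u w * (S ^ k) w v ≤ ∑ w, (S ^ 1) u w * b k :=
          Finset.sum_le_sum fun w _ => mul_le_mul_of_nonneg_left (hub k w) (hnn 1 u w)
      _ = b k := by rw [← Finset.sum_mul, hrow, one_mul]
  have hab : ∀ k, a k ≤ b k := fun k => (hau k (Classical.arbitrary ι)).trans (hub k _)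
  have hcontr : ∀ k, b (k + p) - a (k + p) ≤ (1 - ε) * (b k - a k) := by
    intro k
    obtain ⟨w₀, hw₀⟩ := Finite.exists_min fun u => (S ^ k) u v
    have hak : a k = (S ^ k) w₀ v := le_antisymm (hau k w₀) (le_ciInf hw₀)
    have h1 : b (k + p) ≤ b k - ε * (b k - a k) := by
      refine ciSup_le fun u => ?_
      have h2 : ∑ w, (S ^ p) u w * (b k - (S ^ k) w v) = b k - (S ^ (k + p)) u v := by
        rw [hsplit p k u]
        simp only [mul_sub, Finset.sum_sub_distrib]
        rw [← Finset.sum_mul, hrow, one_mul]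
      have h3 : (S ^ p) u w₀ * (b k - (S ^ k) w₀ v) ≤
          ∑ w, (S ^ p) u w * (b k - (S ^ k) w v) :=
        Finset.single_le_sum (f := fun w => (S ^ p) u w * (b k - (S ^ k) w v))
          (fun w _ => mul_nonneg (hnn p u w) (sub_nonneg.2 (hub k w))) (Finset.mem_univ w₀)
      have h4 : ε * (b k - a k) ≤ (S ^ p) u w₀ * (b k - (S ^ k) w₀ v) := by
        rw [← hak]
        exact mul_le_mul_of_nonneg_right (hεle (u, w₀)) (sub_nonneg.2 (hab k))
      linarith
    have := hamono (Nat.le_add_right k p)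
    nlinarith
  have hatend := tendsto_atTop_ciSup hamono
    ⟨b 0, by rintro _ ⟨k, rfl⟩; exact (hab k).trans (hbanti (Nat.zero_le k))⟩
  have hbtend := tendsto_atTop_ciInf hbanti
    ⟨a 0, by rintro _ ⟨k, rfl⟩; exact (hamono (Nat.zero_le k)).trans (hab k)⟩
  set α := ⨆ k, a k
  set β := ⨅ k, b k
  have hd := hbtend.sub hatend
  have hle : β - α ≤ (1 - ε) * (β - α) :=
    le_of_tendsto_of_tendsto' (hd.comp (tendsto_add_atTop_nat p)) (hd.const_mul _) hcontr
  have hge : α ≤ β := le_of_tendsto_of_tendsto' hatend hbtend hab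
  have heq : β = α := by
    by_contra hne
    have : 0 < β - α := sub_pos.2 (lt_of_le_of_ne hge (Ne.symm hne))
    nlinarith
  refine ⟨α, ?_, fun u => ?_⟩
  · refine lt_of_lt_of_le hε (ge_of_tendsto hatend ?_)
    filter_upwards [eventually_ge_atTop p] with k hk
    exact (le_ciInf fun u => hεle (u, v)).trans (hamono hk)
  · exact tendsto_of_tendsto_of_tendsto_of_le_of_le hatend (heq ▸ hbtend)
      (fun k => hau k u) (fun k => hub k u)

/-- Conjugation with the diagonal matrix of the positive eigenvector `x`, and division by `θ`,
makes `Q` stochastic. -/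
theorem IsPrimitive.tendsto_pow [Nonempty ι] {Q : Matrix ι ι ℝ} (hQ : Q.IsPrimitive) {θ : ℝ}
    (hθ : 0 < θ) {x : ι → ℝ} (hx : ∀ i, 0 < x i) (hQx : Q *ᵥ x = θ • x) :
    ∃ y : ι → ℝ, (∀ i, 0 < y i) ∧ y ⬝ᵥ x = 1 ∧
      ∀ u v, Tendsto (fun k : ℕ => (θ ^ k)⁻¹ * (Q ^ k) u v) atTop (𝓝 (x u * y v)) := by
  obtain ⟨hQ0, p, hp0, hp⟩ := hQ
  set S : Matrix ι ι ℝ := of fun u v => (θ * x u)⁻¹ * Q u v * x v with hS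
  have hSpow : ∀ k u v, (S ^ k) u v = (θ ^ k * x u)⁻¹ * (Q ^ k) u v * x v := by
    intro k
    induction k with
    | zero =>
      intro u v
      simp only [pow_zero, one_apply]
      split_ifs with h
      · subst h
        have := (hx u).ne'
        field_simp
      · simp
    | succ k ih =>
      intro u v
      rw [pow_succ S, pow_succ Q, mul_apply, mul_apply, Finset.mul_sum, Finset.sum_mul]
      refine Finset.sum_congr rfl fun w _ => ?_
      rw [ih, hS, of_apply]
      have h1 := (hx u).ne'
      have h2 := (hx w).ne'
      field_simp
      ring
  have hS0 : ∀ i j, 0 ≤ S i j := fun i j => by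
    have := hx i
    have := hx j
    have := hQ0 i j
    simp only [hS, of_apply]
    positivity
  have hS1 : ∀ i, ∑ j, S i j = 1 := fun i => by
    have h1 : ∑ j, Q i j * x j = θ * x i := congrFun hQx i
    simp only [hS, of_apply, mul_assoc]
    rw [← Finset.mul_sum, h1]
    have := (hx i).ne'
    field_simp
  have hSp : ∀ i j, 0 < (S ^ p) i j := fun i j => by
    rw [hSpow]
    have := hx i
    have := hx j
    have := hp i j
    positivity
  choose c hc hlim using fun v => tendsto_pow_of_rowStochastic hS0 hS1 hSp v
  refine ⟨fun v => c v / x v, fun v => div_pos (hc v) (hx v), ?_, fun u v => ?_⟩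
  · have h1 : (fun v => c v / x v) ⬝ᵥ x = ∑ v, c v := by
      simp only [dotProduct]
      exact Finset.sum_congr rfl fun v _ => div_mul_cancel₀ _ (hx v).ne'
    rw [h1]
    have hone : S *ᵥ 1 = (1 : ℝ) • 1 := by
      ext i
      simp [mulVec, dotProduct, hS1]
    have u := Classical.arbitrary ι
    have h2 : Tendsto (fun k : ℕ => ∑ v, (S ^ k) u v) atTop (𝓝 (∑ v, c v)) :=
      tendsto_finsetSum _ fun v _ => hlim v u
    have h3 : ∀ k, ∑ v, (S ^ k) u v = 1 := fun k => by
      have := congrFun (pow_mulVec_of_mulVec_eq_smul hone k) u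
      simpa [mulVec, dotProduct] using this
    simp only [h3] at h2
    exact tendsto_nhds_unique h2 tendsto_const_nhds
  · have h1 := ((hlim v u).const_mul (x u)).div_const (x v)
    rw [mul_div_assoc] at h1
    refine h1.congr fun k => ?_
    rw [hSpow]
    have h1 := (hx u).ne'
    have h2 := (hx v).ne'
    field_simp

/-- If `Q w = η w`, then `(η / θ) ^ k w` converges; hence `η = θ` or `‖η‖ < θ`. -/
theorem IsPrimitive.isDominantEigenvalue [Nonempty ι] {Q : Matrix ι ι ℝ} (hQ : Q.IsPrimitive)
    {θ : ℝ} (hθ : 0 < θ) {x : ι → ℝ} (hx : ∀ i, 0 < x i) (hQx : Q *ᵥ x = θ • x) :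
    IsDominantEigenvalue Q θ := by
  obtain ⟨y, -, -, hlim⟩ := hQ.tendsto_pow hθ hx hQx
  set QC : Matrix ι ι ℂ := Q.map Complex.ofReal with hQC
  have key : ∀ η : ℂ, η ∈ spectrum ℂ QC ↔ ∃ w : ι → ℂ, w ≠ 0 ∧ QC *ᵥ w = η • w := by
    intro η
    rw [← spectrum_toLin', ← Module.End.hasEigenvalue_iff_mem_spectrum]
    constructor
    · intro h
      obtain ⟨w, hw⟩ := h.exists_hasEigenvector
      exact ⟨w, hw.2, by simpa using hw.apply_eq_smul⟩
    · rintro ⟨w, hw0, hw⟩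
      exact Module.End.hasEigenvalue_of_hasEigenvector
        ⟨Module.End.mem_eigenspace_iff.2 (by simpa using hw), hw0⟩
  refine ⟨(key _).2 ⟨fun i => (x i : ℂ), ?_, ?_⟩, fun η hη hne => ?_⟩
  · intro h
    have := congrFun h (Classical.arbitrary ι)
    simp only [Pi.zero_apply, Complex.ofReal_eq_zero] at this
    exact (hx _).ne' this
  · ext i
    have h1 : ∑ j, Q i j * x j = θ * x i := congrFun hQx i
    simp only [mulVec, dotProduct, hQC, map_apply, Pi.smul_apply, smul_eq_mul]
    exact_mod_cast h1
  · obtain ⟨w, hw0, hw⟩ := (key η).1 hη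
    obtain ⟨i, hi⟩ := Function.ne_iff.1 hw0
    have hpow : ∀ k : ℕ, ∀ i, ∑ j, ((Q ^ k) i j : ℂ) * w j = η ^ k * w i := by
      intro k
      induction k with
      | zero =>
        intro i
        rw [pow_zero, pow_zero, one_mul, Finset.sum_eq_single i]
        · simp
        · intro j _ hj
          rw [one_apply_ne hj.symm]
          simp
        · simp
      | succ k ih =>
        intro i
        have h1 : ∀ l, ∑ j, (Q l j : ℂ) * w j = η * w l := fun l => congrFun hw l
        rw [pow_succ Q, pow_succ' η, mul_assoc, ← ih i, Finset.mul_sum]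
        simp only [mul_apply, Complex.ofReal_sum, Complex.ofReal_mul, Finset.sum_mul]
        rw [Finset.sum_comm]
        refine Finset.sum_congr rfl fun l _ => ?_
        simp only [mul_assoc, ← Finset.mul_sum, h1]
        ring
    have hconv : Tendsto (fun k : ℕ => (η / θ) ^ k * w i) atTop
        (𝓝 (∑ j, ((x i * y j : ℝ) : ℂ) * w j)) := by
      have h1 : Tendsto (fun k : ℕ => ∑ j, (((θ ^ k)⁻¹ * (Q ^ k) i j : ℝ) : ℂ) * w j) atTop
          (𝓝 (∑ j, ((x i * y j : ℝ) : ℂ) * w j)) :=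
        tendsto_finsetSum _ fun j _ =>
          ((Complex.continuous_ofReal.tendsto _).comp (hlim i j)).mul_const _
      refine h1.congr fun k => ?_
      push_cast
      simp only [mul_assoc, ← Finset.mul_sum]
      rw [hpow, div_pow]
      ring
    have hconv' : Tendsto (fun k : ℕ => (η / θ) ^ k) atTop
        (𝓝 ((∑ j, ((x i * y j : ℝ) : ℂ) * w j) / w i)) := by
      refine (hconv.div_const (w i)).congr fun k => ?_
      rw [mul_div_assoc, div_self hi, mul_one]
    by_contra hge
    have hθC : (θ : ℂ) ≠ 0 := by exact_mod_cast hθ.ne'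
    have hnorm : 1 ≤ ‖η / θ‖ := by
      rw [norm_div, Complex.norm_real, Real.norm_eq_abs, abs_of_pos hθ, le_div_iff₀ hθ, one_mul]
      exact not_lt.1 hge
    -- consecutive differences of a convergent geometric sequence tend to `0`
    have hdiff := (hconv'.comp (tendsto_add_atTop_nat 1)).sub hconv'
    rw [sub_self] at hdiff
    have hle : ‖η / θ - 1‖ ≤ 0 := by
      rw [← norm_zero (E := ℂ)]
      refine ge_of_tendsto' hdiff.norm fun k => ?_
      have h2 : (((fun k : ℕ => (η / θ) ^ k) ∘ fun a => a + 1) k - (η / θ) ^ k) =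
          (η / θ) ^ k * (η / θ - 1) := by
        simp only [Function.comp]
        ring
      rw [h2, norm_mul, norm_pow]
      exact le_mul_of_one_le_left (norm_nonneg _) (one_le_pow₀ hnorm)
    have h1 : η / θ = 1 := sub_eq_zero.1 (norm_le_zero_iff.1 hle)
    exact hne ((div_eq_one_iff_eq hθC).1 h1)

end Matrix

theorem IsDominantEigenvalue.dominantEigenvalue_eq {ι : Type*} [Fintype ι] [DecidableEq ι]
    {Q : Matrix ι ι ℝ} {θ : ℝ}
    (h : IsDominantEigenvalue Q θ) : dominantEigenvalue Q = θ := by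
  have hex : ∃ θ, IsDominantEigenvalue Q θ := ⟨θ, h⟩
  rw [dominantEigenvalue, dif_pos hex]
  exact hex.choose_spec.unique h

/-! ### Powers of nonnegative matrices with an invariant set of indices -/

namespace Matrix

variable {ι : Type*} [Fintype ι] [DecidableEq ι] {N : Matrix ι ι ℝ}

theorem pow_apply_eq_zero_of_closed {S : ι → Prop} (hS : ∀ u v, S u → ¬S v → N u v = 0) (k : ℕ)
    {u v : ι} (hu : S u) (hv : ¬S v) : (N ^ k) u v = 0 := by
  induction k generalizing v with
  | zero => exact one_apply_ne fun h => hv (h ▸ hu)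
  | succ k ih =>
    rw [pow_succ, mul_apply]
    refine Finset.sum_eq_zero fun w _ => ?_
    by_cases hw : S w
    · rw [hS w v hw hv, mul_zero]
    · rw [ih hw, zero_mul]

/-- If no path leaves `P` and comes back, then powers of the block indexed by `P` are blocks of
powers. -/
theorem submatrix_val_pow {P : ι → Prop} [Fintype {u // P u}]
    (h : ∀ u w v, P u → ¬P w → P v → ∀ k, (N ^ k) u w * N w v = 0) (k : ℕ) :
    (N.submatrix Subtype.val Subtype.val : Matrix {u // P u} {u // P u} ℝ) ^ k =
      (N ^ k).submatrix Subtype.val Subtype.val := by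
  classical
  induction k with
  | zero =>
    ext u v
    simp [one_apply, Subtype.ext_iff]
  | succ k ih =>
    ext u v
    rw [pow_succ, pow_succ, ih, mul_apply, submatrix_apply, mul_apply]
    simp only [submatrix_apply]
    rw [← Finset.sum_filter_add_sum_filter_not Finset.univ P,
      Finset.sum_eq_zero (s := Finset.univ.filter fun w => ¬P w), add_zero]
    · exact (Finset.sum_subtype _ (fun w => by simp)
        (fun w => (N ^ k) u.1 w * N w v.1)).symm
    · intro w hw
      exact h u.1 w v.1 u.2 (Finset.mem_filter.1 hw).2 v.2 k

section Exit

variable {P : ι → Prop} [DecidablePred P]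

/-- The total weight of the paths of length `l + 1` from `c` to `v` whose first edge ends
outside `P`. -/
def exitWeight (N : Matrix ι ι ℝ) (P : ι → Prop) [DecidablePred P] (l : ℕ) (c v : ι) : ℝ :=
  ∑ e with ¬P e, N c e * (N ^ l) e v

theorem exitWeight_nonneg (hN : ∀ u v, 0 ≤ N u v) (l : ℕ) (c v : ι) :
    0 ≤ exitWeight N P l c v :=
  Finset.sum_nonneg fun e _ => mul_nonneg (hN c e) (pow_apply_nonneg hN l e v)

/-- Paths from `P` to its complement, sorted by the edge along which they leave `P`. -/
theorem pow_apply_eq_sum_exitWeight (hP : ∀ u v, ¬P u → P v → N u v = 0) {u v : ι} (hu : P u)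
    (hv : ¬P v) (k : ℕ) :
    (N ^ k) u v = ∑ l ∈ Finset.range k, ∑ c with P c,
      (N ^ (k - 1 - l)) u c * exitWeight N P l c v := by
  induction k generalizing u with
  | zero =>
    rw [pow_zero, Finset.range_zero, Finset.sum_empty]
    exact one_apply_ne fun h => hv (h ▸ hu)
  | succ k ih =>
    have hstep : ∀ l ∈ Finset.range k, ∑ c with P c,
        (N ^ (k + 1 - 1 - l)) u c * exitWeight N P l c v =
        ∑ w with P w, N u w * ∑ c with P c, (N ^ (k - 1 - l)) w c * exitWeight N P l c v := by
      intro l hl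
      have hl' := Finset.mem_range.1 hl
      have hk : k + 1 - 1 - l = (k - 1 - l) + 1 := by omega
      simp only [Finset.mul_sum]
      rw [Finset.sum_comm]
      refine Finset.sum_congr rfl fun c hc => ?_
      rw [hk, pow_succ', mul_apply, ← Finset.sum_filter_add_sum_filter_not Finset.univ P,
        Finset.sum_eq_zero (s := Finset.univ.filter fun w => ¬P w), add_zero, Finset.sum_mul]
      · exact Finset.sum_congr rfl fun w _ => by ring
      · intro w hw
        rw [pow_apply_eq_zero_of_closed (S := fun w => ¬P w)
          (fun u v hu hv => hP u v hu (not_not.1 hv)) _ (Finset.mem_filter.1 hw).2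
          (not_not.2 (Finset.mem_filter.1 hc).2), mul_zero]
    have hlast : ∑ c with P c, (N ^ (k + 1 - 1 - k)) u c * exitWeight N P k c v =
        exitWeight N P k u v := by
      rw [Nat.add_sub_cancel, Nat.sub_self, pow_zero, Finset.sum_eq_single u, one_apply_eq, one_mul]
      · intro c _ hc
        rw [one_apply_ne hc.symm, zero_mul]
      · intro h
        exact absurd (Finset.mem_filter.2 ⟨Finset.mem_univ u, hu⟩) h
    rw [Finset.sum_range_succ, hlast, Finset.sum_congr rfl hstep, Finset.sum_comm, pow_succ',
      mul_apply, ← Finset.sum_filter_add_sum_filter_not Finset.univ P]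
    refine congrArg₂ (· + ·) (Finset.sum_congr rfl fun w hw => ?_) rfl
    rw [ih (Finset.mem_filter.1 hw).2, Finset.mul_sum]

/-- A discrete convolution of a convergent sequence with a geometrically bounded one. -/
theorem tendsto_sum_range_mul_of_le_geometric {a g : ℕ → ℝ} {α K q : ℝ}
    (ha : Tendsto a atTop (𝓝 α)) (hg : ∀ l, |g l| ≤ K * q ^ l) (hq0 : 0 ≤ q) (hq1 : q < 1) :
    Tendsto (fun k => ∑ l ∈ Finset.range (k + 1), a (k - l) * g l) atTop
      (𝓝 (α * ∑' l, g l)) := by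
  obtain ⟨B, hB⟩ : ∃ B, ∀ k, |a k| ≤ B := by
    obtain ⟨B, hB⟩ := ha.abs.bddAbove_range
    exact ⟨B, fun k => hB ⟨k, rfl⟩⟩
  have hB0 : 0 ≤ B := (abs_nonneg _).trans (hB 0)
  have key := tendsto_tsum_of_dominated_convergence (𝓕 := atTop)
    (f := fun k l => if l ∈ Finset.range (k + 1) then a (k - l) * g l else 0)
    (g := fun l => α * g l) (bound := fun l => B * (K * q ^ l))
    (((summable_geometric_of_lt_one hq0 hq1).mul_left K).mul_left B)
    (fun l => by
      have h1 : Tendsto (fun k => a (k - l) * g l) atTop (𝓝 (α * g l)) :=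
        (ha.comp (tendsto_sub_atTop_nat l)).mul_const _
      refine h1.congr' ?_
      filter_upwards [eventually_ge_atTop l] with k hk
      rw [if_pos (Finset.mem_range.2 (by omega))])
    (Eventually.of_forall fun k l => by
      split_ifs
      · rw [Real.norm_eq_abs, abs_mul]
        exact mul_le_mul (hB _) (hg l) (abs_nonneg _) hB0
      · rw [norm_zero]
        exact mul_nonneg hB0 ((abs_nonneg _).trans (hg l)))
  rw [tsum_mul_left] at key
  refine key.congr fun k => ?_
  rw [tsum_eq_sum (s := Finset.range (k + 1)) fun l hl => if_neg hl]
  exact Finset.sum_congr rfl fun l hl => if_pos hl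

/-- If the block `P` grows like `θ ^ k` and the rest strictly slower, then so does every entry
that leads out of `P`, and the limit still factors. -/
theorem exists_tendsto_pow_of_exit (hN : ∀ u v, 0 ≤ N u v)
    (hP : ∀ u v, ¬P u → P v → N u v = 0) {θ : ℝ} (hθ : 0 < θ) {x y : ι → ℝ}
    (hlim : ∀ u c, P u → P c →
      Tendsto (fun k : ℕ => (θ ^ k)⁻¹ * (N ^ k) u c) atTop (𝓝 (x u * y c)))
    {v : ι} (hv : ¬P v) {C μ : ℝ} (hμ0 : 0 ≤ μ) (hμ : μ < θ)
    (hC : ∀ e, ¬P e → ∀ l, (N ^ l) e v ≤ C * μ ^ l) :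
    ∃ b : ℝ, ∀ u, P u → Tendsto (fun k : ℕ => (θ ^ k)⁻¹ * (N ^ k) u v) atTop (𝓝 (x u * b)) := by
  set g : ι → ℕ → ℝ := fun c l => (θ ^ (l + 1))⁻¹ * exitWeight N P l c v with hg
  refine ⟨∑ c with P c, y c * ∑' l, g c l, fun u hu => ?_⟩
  have h1 : ∀ c ∈ Finset.univ.filter P, Tendsto (fun k => ∑ l ∈ Finset.range (k + 1),
      ((θ ^ (k - l))⁻¹ * (N ^ (k - l)) u c) * g c l) atTop (𝓝 (x u * y c * ∑' l, g c l)) := by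
    intro c hc
    refine tendsto_sum_range_mul_of_le_geometric (a := fun k => (θ ^ k)⁻¹ * (N ^ k) u c)
      (g := g c) (α := x u * y c) (q := μ / θ)
      (K := θ⁻¹ * ((∑ e with ¬P e, N c e) * C)) (hlim u c hu (Finset.mem_filter.1 hc).2)
      (fun l => ?_) (div_nonneg hμ0 hθ.le) ((div_lt_one hθ).2 hμ)
    have h2 : exitWeight N P l c v ≤ (∑ e with ¬P e, N c e) * C * μ ^ l := by
      rw [mul_assoc, Finset.sum_mul]
      exact Finset.sum_le_sum fun e he =>
        mul_le_mul_of_nonneg_left (hC e (Finset.mem_filter.1 he).2 l) (hN c e)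
    rw [abs_of_nonneg (mul_nonneg (inv_nonneg.2 (pow_nonneg hθ.le _)) (exitWeight_nonneg hN l c v))]
    calc (θ ^ (l + 1))⁻¹ * exitWeight N P l c v
        ≤ (θ ^ (l + 1))⁻¹ * ((∑ e with ¬P e, N c e) * C * μ ^ l) :=
          mul_le_mul_of_nonneg_left h2 (inv_nonneg.2 (pow_nonneg hθ.le _))
      _ = _ := by
        rw [div_pow, pow_succ, mul_inv]
        ring
  have h3 := tendsto_finsetSum _ h1
  rw [← tendsto_add_atTop_iff_nat 1, Finset.mul_sum]
  simp only [mul_assoc] at h3 ⊢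
  refine h3.congr fun k => ?_
  rw [pow_apply_eq_sum_exitWeight hP hu hv, Finset.sum_comm, Finset.mul_sum]
  refine Finset.sum_congr rfl fun l hl => ?_
  rw [Finset.mul_sum]
  refine Finset.sum_congr rfl fun c _ => ?_
  have hk : k + 1 = (k - l) + (l + 1) := by
    have := Finset.mem_range.1 hl
    omega
  have hk' : k + 1 - 1 - l = k - l := by omega
  rw [hk', hg]
  conv_rhs => rw [hk, pow_add, mul_inv]
  ring

/-- If both `P` and what lies behind some edge out of `P` grow at least like `θ ^ k`, then paths
may use that edge at any time, which contributes a further factor `k`. -/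
theorem tendsto_atTop_pow_of_exit (hN : ∀ u v, 0 ≤ N u v)
    (hP : ∀ u v, ¬P u → P v → N u v = 0) {θ : ℝ} (hθ : 0 < θ) {u c e v : ι} (hu : P u) (hc : P c)
    (he : ¬P e) (hv : ¬P v) (hce : 0 < N c e) {a : ℝ} (ha : 0 < a)
    (hlim : Tendsto (fun k : ℕ => (θ ^ k)⁻¹ * (N ^ k) u c) atTop (𝓝 a)) {b : ℝ} (hb : 0 < b)
    (hev : ∀ᶠ l in atTop, b * θ ^ l ≤ (N ^ l) e v) :
    Tendsto (fun k : ℕ => (θ ^ k)⁻¹ * (N ^ k) u v) atTop atTop := by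
  obtain ⟨J, hJ⟩ := eventually_atTop.1 (hlim.eventually_const_le (half_lt_self ha))
  obtain ⟨L, hL⟩ := eventually_atTop.1 hev
  set d : ℝ := a / 2 * (N c e * b) * θ⁻¹ with hd
  have hd0 : 0 < d := by positivity
  have hle : ∀ k, ((k - J - L : ℕ) : ℝ) * d ≤ (θ ^ k)⁻¹ * (N ^ k) u v := by
    intro k
    rw [pow_apply_eq_sum_exitWeight hP hu hv, Finset.mul_sum]
    have hterm : ∀ l ∈ Finset.Ico L (k - J), d ≤ (θ ^ k)⁻¹ * ∑ c with P c,
        (N ^ (k - 1 - l)) u c * exitWeight N P l c v := by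
      intro l hl
      obtain ⟨hl1, hl2⟩ := Finset.mem_Ico.1 hl
      have h1 : (N ^ (k - 1 - l)) u c * exitWeight N P l c v ≤ ∑ c with P c,
          (N ^ (k - 1 - l)) u c * exitWeight N P l c v :=
        Finset.single_le_sum (f := fun c => (N ^ (k - 1 - l)) u c * exitWeight N P l c v)
          (fun c _ => mul_nonneg (pow_apply_nonneg hN _ u c) (exitWeight_nonneg hN l c v))
          (Finset.mem_filter.2 ⟨Finset.mem_univ c, hc⟩)
      have h2 : N c e * (N ^ l) e v ≤ exitWeight N P l c v :=
        Finset.single_le_sum (f := fun e => N c e * (N ^ l) e v)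
          (fun e _ => mul_nonneg (hN c e) (pow_apply_nonneg hN l e v))
          (Finset.mem_filter.2 ⟨Finset.mem_univ e, he⟩)
      have h3 := hJ (k - 1 - l) (by omega)
      have h4 := mul_le_mul_of_nonneg_left (hL l hl1) hce.le
      have h5 : θ ^ k = θ ^ (k - 1 - l) * θ ^ l * θ := by
        rw [← pow_add, ← pow_succ]
        congr 1
        omega
      have hp1 : 0 < θ ^ (k - 1 - l) := pow_pos hθ _
      have hp2 : 0 < θ ^ l := pow_pos hθ _
      calc d = a / 2 * ((θ ^ l)⁻¹ * (N c e * (b * θ ^ l))) * θ⁻¹ := by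
            rw [hd]
            field_simp
        _ ≤ (θ ^ (k - 1 - l))⁻¹ * (N ^ (k - 1 - l)) u c *
            ((θ ^ l)⁻¹ * exitWeight N P l c v) * θ⁻¹ := by
            refine mul_le_mul_of_nonneg_right (mul_le_mul h3
              (mul_le_mul_of_nonneg_left (h4.trans h2) (inv_nonneg.2 hp2.le)) (by positivity)
              (mul_nonneg (inv_nonneg.2 hp1.le) (pow_apply_nonneg hN _ u c)))
              (inv_nonneg.2 hθ.le)
        _ = (θ ^ k)⁻¹ * ((N ^ (k - 1 - l)) u c * exitWeight N P l c v) := by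
            rw [h5, mul_inv, mul_inv]
            ring
        _ ≤ _ := mul_le_mul_of_nonneg_left h1 (inv_nonneg.2 (pow_nonneg hθ.le k))
    calc ((k - J - L : ℕ) : ℝ) * d = ∑ _l ∈ Finset.Ico L (k - J), d := by
          rw [Finset.sum_const, Nat.card_Ico, nsmul_eq_mul]
      _ ≤ ∑ l ∈ Finset.Ico L (k - J), (θ ^ k)⁻¹ * ∑ c with P c,
          (N ^ (k - 1 - l)) u c * exitWeight N P l c v := Finset.sum_le_sum hterm
      _ ≤ _ := by
          refine Finset.sum_le_sum_of_subset_of_nonneg (fun l hl => ?_) fun l _ _ => ?_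
          · have := Finset.mem_Ico.1 hl
            exact Finset.mem_range.2 (by omega)
          · exact mul_nonneg (inv_nonneg.2 (pow_nonneg hθ.le k)) (Finset.sum_nonneg fun c _ =>
              mul_nonneg (pow_apply_nonneg hN _ u c) (exitWeight_nonneg hN l c v))
  refine tendsto_atTop_mono hle (Tendsto.atTop_mul_const hd0 ?_)
  exact tendsto_natCast_atTop_atTop.comp
    ((tendsto_sub_atTop_nat L).comp (tendsto_sub_atTop_nat J))

end Exit

end Matrix

/-! ### Iterated substitutions and their incidence matrices -/

namespace Substitution

variable {A : Type*} (σ : Substitution A)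

theorem onWord_iterate_append (k : ℕ) (x y : List A) :
    σ.onWord^[k] (x ++ y) = σ.onWord^[k] x ++ σ.onWord^[k] y := by
  induction k generalizing x y with
  | zero => rfl
  | succ k ih =>
    rw [Function.iterate_succ_apply, Function.iterate_succ_apply, Function.iterate_succ_apply, ← ih]
    simp [onWord]

theorem onWord_iterate_nil (k : ℕ) : σ.onWord^[k] [] = [] := by
  induction k with
  | zero => rfl
  | succ k ih => rw [Function.iterate_succ_apply]; exact ih

theorem length_le_onWord_iterate (k : ℕ) (w : List A) : w.length ≤ (σ.onWord^[k] w).length := by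
  induction k generalizing w with
  | zero => exact le_rfl
  | succ k ih =>
    rw [Function.iterate_succ_apply]
    exact (σ.length_le_onWord w).trans (ih _)

theorem onWord_iterate_infix (k : ℕ) {u w : List A} (h : u <:+: w) :
    σ.onWord^[k] u <:+: σ.onWord^[k] w := by
  induction k generalizing u w with
  | zero => exact h
  | succ k ih => exact ih (σ.onWord_infix h)

theorem onWord_singleton (a : A) : σ.onWord [a] = σ.toFun a := by
  simp [onWord]

theorem iter_succ (k : ℕ) (a : A) : σ.iter (k + 1) a = σ.onWord^[k] (σ.toFun a) := by
  rw [iter, Function.iterate_succ_apply, onWord_singleton]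

theorem mem_onWord_iterate {k : ℕ} {w : List A} {b : A} :
    b ∈ σ.onWord^[k] w ↔ ∃ c ∈ w, b ∈ σ.iter k c := by
  induction w with
  | nil => simp [onWord_iterate_nil]
  | cons c w ih =>
    rw [show c :: w = [c] ++ w from rfl, onWord_iterate_append, List.mem_append, ih]
    simp [iter]

theorem mem_of_mem_iter {B : Finset A} (hB : ∀ a ∈ B, ∀ b ∈ σ.toFun a, b ∈ B) {k : ℕ} {a b : A}
    (ha : a ∈ B) (hb : b ∈ σ.iter k a) : b ∈ B := by
  induction k generalizing a with
  | zero =>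
    rw [iter, Function.iterate_zero_apply, List.mem_singleton] at hb
    exact hb ▸ ha
  | succ k ih =>
    rw [iter_succ, mem_onWord_iterate] at hb
    obtain ⟨c, hc, hb⟩ := hb
    exact ih (hB a ha c hc) hb

theorem incidence_nonneg [DecidableEq A] (a b : A) : 0 ≤ σ.incidence a b :=
  Nat.cast_nonneg _

theorem sum_incidence_mul [Fintype A] [DecidableEq A] (a : A) (g : A → ℝ) :
    ∑ b, σ.incidence a b * g b = ((σ.toFun a).map g).sum := by
  rw [Finset.sum_list_map_count, ← Finset.sum_subset (Finset.subset_univ (σ.toFun a).toFinset)]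
  · exact Finset.sum_congr rfl fun b _ => by rw [nsmul_eq_mul]; rfl
  · intro b _ hb
    have : (σ.toFun a).count b = 0 := List.count_eq_zero.2 fun h => hb (List.mem_toFinset.2 h)
    simp [incidence, this]

theorem count_onWord_iterate [DecidableEq A] (k : ℕ) (w : List A) (b : A) :
    (σ.onWord^[k] w).count b = (w.map fun c => (σ.iter k c).count b).sum := by
  induction w with
  | nil => simp [onWord_iterate_nil]
  | cons c w ih =>
    rw [show c :: w = [c] ++ w from rfl, onWord_iterate_append, List.count_append, ih]
    simp [iter]

theorem incidence_pow_apply [Fintype A] [DecidableEq A] (k : ℕ) (a b : A) :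
    (σ.incidence ^ k) a b = ((σ.iter k a).count b : ℝ) := by
  induction k generalizing a with
  | zero =>
    rw [pow_zero, Matrix.one_apply, iter, Function.iterate_zero_apply, List.count_singleton]
    by_cases h : a = b
    · simp [h]
    · simp [h]
  | succ k ih =>
    rw [pow_succ', Matrix.mul_apply, sum_incidence_mul σ a fun c => (σ.incidence ^ k) c b,
      iter_succ, count_onWord_iterate, Nat.cast_list_sum, List.map_map]
    congr 1
    exact List.map_congr_left fun c _ => ih c

/-! ### Windows: the combinatorial meaning of the powers of the auxiliary matrices -/

/-- The number of positions `p < q` at which the window of length `m` in `W` is `v`. -/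
def windowCount [DecidableEq A] (m : ℕ) (W : List A) (q : ℕ) (v : List A) : ℕ :=
  ∑ p ∈ Finset.range q, if (W.drop p).take m = v then 1 else 0

/-- The occurrences of `v` in `σ^k(W)`, sorted by the letter of `W` in whose image they start: they
depend only on the window of length `m` at that letter. -/
theorem sum_windowCount [DecidableEq A] (k : ℕ) {m : ℕ} (hm : 1 ≤ m) (W v : List A) (q : ℕ)
    (hq : q + m ≤ W.length + 1) :
    ∑ p ∈ Finset.range q, windowCount m (σ.onWord^[k] ((W.drop p).take m))
      (σ.onWord^[k] ((W.drop p).take 1)).length v =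
    windowCount m (σ.onWord^[k] W) (σ.onWord^[k] (W.take q)).length v := by
  induction q with
  | zero => simp [onWord_iterate_nil, windowCount]
  | succ q ih =>
    have hlen : (σ.onWord^[k] (W.take (q + 1))).length =
        (σ.onWord^[k] (W.take q)).length + (σ.onWord^[k] ((W.drop q).take 1)).length := by
      rw [List.take_add, onWord_iterate_append, List.length_append]
    rw [Finset.sum_range_succ, ih (by omega), hlen, windowCount, windowCount, windowCount,
      Finset.sum_range_add]
    congr 1
    refine Finset.sum_congr rfl fun p hp => ?_
    have hp' := Finset.mem_range.1 hp
    set X := σ.onWord^[k] (W.take q)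
    set Y := σ.onWord^[k] ((W.drop q).take m) with hY
    have hW : σ.onWord^[k] W = X ++ (Y ++ σ.onWord^[k] ((W.drop q).drop m)) := by
      rw [← onWord_iterate_append, List.take_append_drop, ← onWord_iterate_append,
        List.take_append_drop]
    have hYlen : p + m ≤ Y.length := by
      have h1 : (W.drop q).take m = (W.drop q).take 1 ++ ((W.drop q).drop 1).take (m - 1) := by
        rw [← List.take_add]
        congr 1
        omega
      have h2 := σ.length_le_onWord_iterate k (((W.drop q).drop 1).take (m - 1))
      rw [hY, h1, onWord_iterate_append, List.length_append]
      rw [List.length_take, List.length_drop, List.length_drop] at h2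
      omega
    rw [hW, ← List.drop_drop, List.drop_left, List.drop_append_of_le_length (by omega),
      List.take_append_of_le_length (by rw [List.length_drop]; omega)]

section Aux

theorem take_one_eq_head {B : Finset A} {m : ℕ} (hm : 1 ≤ m) (u : σ.lang B m) :
    u.1.take 1 = [u.1.head (σ.ne_nil_of_mem_lang hm u.2)] := by
  obtain ⟨u, hu⟩ := u
  cases u with
  | nil => exact absurd rfl (σ.ne_nil_of_mem_lang hm hu)
  | cons a t => simp

theorem onWord_eq_toFun_head_append {B : Finset A} {m : ℕ} (hm : 1 ≤ m) (u : σ.lang B m) :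
    σ.onWord u.1 = σ.toFun (u.1.head (σ.ne_nil_of_mem_lang hm u.2)) ++ σ.onWord (u.1.drop 1) := by
  obtain ⟨u, hu⟩ := u
  cases u with
  | nil => exact absurd rfl (σ.ne_nil_of_mem_lang hm hu)
  | cons a t => simp [onWord]

variable [Fintype A] [DecidableEq A] {B : Finset A} {m : ℕ} (hm : 1 ≤ m)

theorem sum_aux_incidence_mul (u : σ.lang B m) (g : σ.lang B m → ℝ) :
    ∑ v, (σ.aux B m hm).incidence u v * g v =
      ∑ j : Fin (σ.toFun (u.1.head (σ.ne_nil_of_mem_lang hm u.2))).length,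
        g ⟨((σ.onWord u.1).drop j).take m, σ.window_mem_lang hm u.2 j.2⟩ := by
  rw [sum_incidence_mul, aux, List.map_ofFn, List.sum_ofFn]
  rfl

/-- The `(u, v)`-entry of the `k`-th power of the matrix of `σ^{(m)}` is the number of the windows
of `σ^k(u)` that start in `σ^k(u_1)` and are equal to `v`. It does not depend on the
subalphabet `B`. -/
theorem aux_incidence_pow_apply (k : ℕ) (u v : σ.lang B m) :
    ((σ.aux B m hm).incidence ^ k) u v =
      (windowCount m (σ.onWord^[k] u.1) (σ.onWord^[k] (u.1.take 1)).length v.1 : ℝ) := by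
  induction k generalizing u with
  | zero =>
    have h1 : (u.1.take m) = u.1 := List.take_of_length_le u.2.1.le
    rw [pow_zero, Matrix.one_apply, windowCount, Function.iterate_zero_apply,
      Function.iterate_zero_apply, σ.take_one_eq_head hm]
    rw [List.length_singleton, Finset.sum_range_one, List.drop_zero, h1]
    simp [Subtype.ext_iff]
  | succ k ih =>
    have hhead := σ.take_one_eq_head hm u
    set a := u.1.head (σ.ne_nil_of_mem_lang hm u.2) with ha
    have hW : σ.onWord u.1 = σ.toFun a ++ σ.onWord (u.1.drop 1) :=
      σ.onWord_eq_toFun_head_append hm u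
    have hlen : (σ.toFun a).length + m ≤ (σ.onWord u.1).length + 1 := by
      have h1 := σ.length_le_onWord (u.1.drop 1)
      have h2 := u.2.1
      rw [List.length_drop] at h1
      rw [hW, List.length_append]
      omega
    have htake : (σ.onWord u.1).take (σ.toFun a).length = σ.toFun a := by
      rw [hW, List.take_left]
    rw [pow_succ', Matrix.mul_apply,
      σ.sum_aux_incidence_mul hm u fun w => ((σ.aux B m hm).incidence ^ k) w v,
      Function.iterate_succ_apply, Function.iterate_succ_apply, hhead, onWord_singleton]
    conv_rhs => rw [← htake]
    rw [← σ.sum_windowCount k hm _ _ _ hlen, Nat.cast_sum,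
      ← Fin.sum_univ_eq_sum_range (n := (σ.toFun a).length) fun p =>
        ((windowCount m (σ.onWord^[k] (((σ.onWord u.1).drop p).take m))
          (σ.onWord^[k] (((σ.onWord u.1).drop p).take 1)).length v.1 : ℕ) : ℝ)]
    refine Finset.sum_congr rfl fun j _ => ?_
    rw [ih, List.take_take, Nat.min_eq_left hm]

theorem aux_incidence_pow_incl (k : ℕ) (u v : σ.lang B m) :
    ((σ.aux Finset.univ m hm).incidence ^ k) (σ.incl u) (σ.incl v) =
      ((σ.aux B m hm).incidence ^ k) u v := by
  rw [aux_incidence_pow_apply, aux_incidence_pow_apply]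
  rfl

/-- The first letters of the windows that start in `σ(u_1)` are the letters of `σ(u_1)`. -/
theorem sum_aux_incidence_mul_head (u : σ.lang B m) (g : A → ℝ) :
    ∑ v : σ.lang B m, (σ.aux B m hm).incidence u v *
        g (v.1.head (σ.ne_nil_of_mem_lang hm v.2)) =
      ∑ b, σ.incidence (u.1.head (σ.ne_nil_of_mem_lang hm u.2)) b * g b := by
  rw [σ.sum_aux_incidence_mul hm u fun v => g (v.1.head (σ.ne_nil_of_mem_lang hm v.2)),
    sum_incidence_mul,
    ← Fin.sum_univ_fun_getElem]
  refine Finset.sum_congr rfl fun j _ => congrArg g ?_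
  simp only [List.head_take, List.head_drop]
  simp only [σ.onWord_eq_toFun_head_append hm u]
  exact List.getElem_append_left j.2

end Aux

end Substitution

/-! ### Substitutions of primitive components: positivity and eigenvectors of the blocks -/

namespace Substitution

variable {A : Type*} (σ : Substitution A)

/-- The first letter of a word of `L_m`. -/
abbrev firstLetter {B : Finset A} {m : ℕ} (hm : 1 ≤ m) (u : σ.lang B m) : A :=
  u.1.head (σ.ne_nil_of_mem_lang hm u.2)

theorem mem_of_mem_lang {B' : Finset A} (hB : ∀ a ∈ B', ∀ b ∈ σ.toFun a, b ∈ B') {m : ℕ}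
    {w : List A} (hw : w ∈ σ.lang B' m) {b : A} (hb : b ∈ w) : b ∈ B' := by
  obtain ⟨-, k, -, a, ha, h⟩ := hw
  exact σ.mem_of_mem_iter hB ha (h.subset hb)

theorem firstLetter_mem {B : Finset A} (hB : ∀ a ∈ B, ∀ b ∈ σ.toFun a, b ∈ B) {m : ℕ}
    (hm : 1 ≤ m) (u : σ.lang B m) : σ.firstLetter hm u ∈ B :=
  σ.mem_of_mem_lang hB u.2 (List.head_mem _)

theorem incidence_eq_zero_of_notMem [DecidableEq A] {a b : A} (h : b ∉ σ.toFun a) : σ.incidence a b = 0 := by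
  simp [incidence, List.count_eq_zero.2 h]

section Matrices

variable [Fintype A] [DecidableEq A] {B : Finset A} {m : ℕ} (hm : 1 ≤ m)

/-- The words whose first letter lies in a subalphabet preserved by `σ` are closed under
`σ^{(m)}`. -/
theorem aux_incidence_eq_zero {B' : Finset A} (hB' : ∀ a ∈ B', ∀ b ∈ σ.toFun a, b ∈ B')
    {u v : σ.lang B m} (hu : σ.firstLetter hm u ∈ B') (hv : σ.firstLetter hm v ∉ B') :
    (σ.aux B m hm).incidence u v = 0 := by
  have h := σ.sum_aux_incidence_mul_head hm u fun b => if b ∈ B' then 0 else 1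
  rw [Finset.sum_eq_zero (s := (Finset.univ : Finset A)), Finset.sum_eq_zero_iff_of_nonneg] at h
  · simpa [hv] using h v (Finset.mem_univ v)
  · intro w _
    refine mul_nonneg (incidence_nonneg _ u w) ?_
    split_ifs <;> norm_num
  · intro b _
    by_cases hb : b ∈ B'
    · simp [hb]
    · rw [σ.incidence_eq_zero_of_notMem fun h => hb (hB' _ hu b h), zero_mul]

open Classical in
/-- If `σ` preserves `B'` and `u_1 ∈ B'`, then the windows that lie inside `σ^k(u_1)` belong to
`L_m` of the restriction of `σ` to `B'`; only the last `m - 1` windows may fail to. The bound is `m` because for `k = 0` the single window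
`u` itself need not belong to it, since `L_m` only involves `σ^k(a)` with `k ≥ 1`. -/
theorem sum_aux_incidence_pow_le {B' : Finset A} (u : σ.lang B m)
    (hu : σ.firstLetter hm u ∈ B') (k : ℕ) :
    (((σ.aux B m hm).incidence ^ k).mulVec fun v => if v.1 ∈ σ.lang B' m then 0 else 1) u ≤ m := by
  set L := (σ.onWord^[k] (u.1.take 1)).length with hL
  set W := σ.onWord^[k] u.1 with hW
  have hone : ∀ p, ∑ v : σ.lang B m, (if (W.drop p).take m = v.1 then (1 : ℝ) else 0) *
      (if v.1 ∈ σ.lang B' m then 0 else 1) ≤ 1 := by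
    intro p
    by_cases hex : ∃ v₀ : σ.lang B m, (W.drop p).take m = v₀.1
    · obtain ⟨v₀, hv₀⟩ := hex
      rw [Finset.sum_eq_single v₀]
      · split_ifs <;> norm_num
      · intro v _ hv
        rw [hv₀, if_neg fun h => hv (Subtype.ext h.symm), zero_mul]
      · intro h
        exact absurd (Finset.mem_univ v₀) h
    · rw [Finset.sum_eq_zero]
      · norm_num
      · intro v _
        rw [if_neg fun h => hex ⟨v, h⟩, zero_mul]
  have hsum : (((σ.aux B m hm).incidence ^ k).mulVec
      fun v => if v.1 ∈ σ.lang B' m then 0 else 1) u =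
      ∑ p ∈ Finset.range L, ∑ v : σ.lang B m, (if (W.drop p).take m = v.1 then (1 : ℝ) else 0) *
      (if v.1 ∈ σ.lang B' m then 0 else 1) := by
    rw [Finset.sum_comm, Matrix.mulVec, dotProduct]
    refine Finset.sum_congr rfl fun v _ => ?_
    rw [aux_incidence_pow_apply, windowCount, Nat.cast_sum, Finset.sum_mul]
    exact Finset.sum_congr rfl fun p _ => by rw [Nat.cast_ite, Nat.cast_one, Nat.cast_zero]
  rw [hsum]
  rcases Nat.eq_zero_or_pos k with rfl | hk
  · have hL1 : L = 1 := by
      rw [hL, Function.iterate_zero_apply, σ.take_one_eq_head hm, List.length_singleton]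
    rw [hL1, Finset.sum_range_one]
    exact (hone 0).trans (by exact_mod_cast hm)
  · have hle : ∀ p ∈ Finset.range L, ∑ v : σ.lang B m,
        (if (W.drop p).take m = v.1 then (1 : ℝ) else 0) *
        (if v.1 ∈ σ.lang B' m then 0 else 1) ≤ if L < p + m then 1 else 0 := by
      intro p _
      split_ifs with hp
      · exact hone p
      · refine (Finset.sum_eq_zero fun v _ => ?_).le
        by_cases hv : (W.drop p).take m = v.1
        · rw [if_pos (show v.1 ∈ σ.lang B' m from ⟨v.2.1, k, hk, _, hu, ?_⟩), mul_zero]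
          rw [← hv, iter, ← σ.take_one_eq_head hm u]
          have hsplit : W = σ.onWord^[k] (u.1.take 1) ++ σ.onWord^[k] (u.1.drop 1) := by
            rw [← onWord_iterate_append, List.take_append_drop]
          rw [hsplit, List.drop_append_of_le_length (by omega),
            List.take_append_of_le_length (by rw [List.length_drop]; omega)]
          exact (List.take_prefix _ _).isInfix.trans (List.drop_suffix _ _).isInfix
        · rw [if_neg hv, zero_mul]
    refine (Finset.sum_le_sum hle).trans ?_
    rw [Finset.sum_boole]
    have hcard : ((Finset.range L).filter fun p => L < p + m).card ≤ (Finset.Ico (L - m) L).card := by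
      refine Finset.card_le_card fun p hp => ?_
      rw [Finset.mem_filter, Finset.mem_range] at hp
      exact Finset.mem_Ico.2 ⟨by omega, hp.1⟩
    rw [Nat.card_Ico] at hcard
    exact_mod_cast hcard.trans (by omega)

end Matrices

namespace IsOfPrimitiveComponents

variable {σ} [Fintype A] {n : ℕ} {F : ℕ → Finset A}

theorem closed' (hσ : σ.IsOfPrimitiveComponents n F) {i : ℕ} (hi : i ≤ n) :
    ∀ a ∈ F i, ∀ b ∈ σ.toFun a, b ∈ F i := by
  rcases Nat.eq_zero_or_pos i with rfl | h
  · rw [hσ.zero]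
    simp
  · exact hσ.closed i h hi

theorem mono (hσ : σ.IsOfPrimitiveComponents n F) {i j : ℕ} (hij : i ≤ j) (hj : j ≤ n) :
    F i ⊆ F j := by
  induction j, hij using Nat.le_induction with
  | base => exact subset_rfl
  | succ j hij ih => exact (ih (by omega)).trans (hσ.ssubset j (by omega)).subset

theorem eventually_mem_iter (hσ : σ.IsOfPrimitiveComponents n F) :
    ∃ K, 1 ≤ K ∧ ∀ k, K ≤ k → ∀ i, 1 ≤ i → i ≤ n → ∀ a ∈ F i, a ∉ F (i - 1) →
      ∀ b ∈ F i, b ∈ σ.iter k a := by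
  obtain ⟨K, hK, h⟩ := hσ.primitive
  refine ⟨K, hK, fun k hk => ?_⟩
  induction k, hk using Nat.le_induction with
  | base => exact h
  | succ k hk ih =>
    intro i hi hin a ha ha' b hb
    -- some letter of `σ a` lies at the level of `a`, since `a` recurs in `σ^K(a)`
    obtain ⟨c, hc, hac⟩ : ∃ c ∈ σ.toFun a, a ∈ σ.iter (K - 1) c := by
      rw [← mem_onWord_iterate, ← iter_succ, Nat.sub_add_cancel hK]
      exact h i hi hin a ha ha' a ha
    rw [iter_succ, mem_onWord_iterate]
    exact ⟨c, hc, ih i hi hin c (hσ.closed i hi hin a ha c hc)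
      (fun hc' => ha' (σ.mem_of_mem_iter (hσ.closed' (by omega)) hc' hac)) b hb⟩

variable [DecidableEq A]

theorem isPrimitive_diagBlock (hσ : σ.IsOfPrimitiveComponents n F) {i : ℕ} (hi : 1 ≤ i)
    (hin : i ≤ n) : (σ.diagBlock F i).IsPrimitive := by
  obtain ⟨k, hk, h⟩ := hσ.primitive
  refine ⟨fun a b => σ.incidence_nonneg _ _, k, hk, fun a b => ?_⟩
  have hpow : σ.diagBlock F i ^ k = (σ.incidence ^ k).submatrix Subtype.val Subtype.val := by
    refine @Matrix.submatrix_val_pow A _ _ σ.incidence (fun a => a ∈ F i \ F (i - 1))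
      (Finset.Subtype.fintype _) ?_ k
    intro u w v hu hw hv l
    rw [Finset.mem_sdiff] at hu hw hv
    by_cases hwi : w ∈ F i
    · have hw' : w ∈ F (i - 1) := by
        by_contra h
        exact hw ⟨hwi, h⟩
      rw [σ.incidence_eq_zero_of_notMem fun h => hv.2 (hσ.closed' (by omega) w hw' v h), mul_zero]
    · rw [Matrix.pow_apply_eq_zero_of_closed (S := fun a => a ∈ F i) (fun a b ha hb =>
        σ.incidence_eq_zero_of_notMem fun h => hb (hσ.closed i hi hin a ha b h)) l hu.1 hwi,
        zero_mul]
  rw [hpow, Matrix.submatrix_apply, incidence_pow_apply, Nat.cast_pos, List.count_pos_iff]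
  have ha := Finset.mem_sdiff.1 a.2
  exact h i hi hin a.1 ha.1 ha.2 b.1 (Finset.mem_sdiff.1 b.2).1

/-- The Perron–Frobenius eigenvector of the block `Q_i`, extended by zero to all letters. -/
theorem exists_eigenvector (hσ : σ.IsOfPrimitiveComponents n F) {i : ℕ} (hi : 1 ≤ i)
    (hin : i ≤ n) :
    0 < σ.theta F i ∧ ∃ z : A → ℝ, (∀ a ∈ F i, a ∉ F (i - 1) → 0 < z a) ∧
      (∀ a, a ∉ F i → z a = 0) ∧ (∀ a ∈ F (i - 1), z a = 0) ∧
      ∀ a ∈ F i, ∑ b, σ.incidence a b * z b = σ.theta F i * z a := by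
  have hprim := hσ.isPrimitive_diagBlock hi hin
  have hne : Nonempty ↥(F i \ F (i - 1)) := by
    have hss := hσ.ssubset (i - 1) (by omega)
    rw [Nat.sub_add_cancel hi] at hss
    obtain ⟨a, ha, ha'⟩ := Finset.exists_of_ssubset hss
    exact ⟨⟨a, Finset.mem_sdiff.2 ⟨ha, ha'⟩⟩⟩
  obtain ⟨θ, x, hθ, hx, hQx⟩ := hprim.exists_pos_eigenvector
  have hθi : σ.theta F i = θ :=
    (hprim.isDominantEigenvalue hθ hx hQx).dominantEigenvalue_eq
  rw [hθi]
  refine ⟨hθ, fun a => if h : a ∈ F i \ F (i - 1) then x ⟨a, h⟩ else 0, fun a ha ha' => ?_,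
    fun a ha => ?_, fun a ha => ?_, fun a ha => ?_⟩
  · simp only [Finset.mem_sdiff.2 ⟨ha, ha'⟩, dif_pos]
    exact hx _
  · exact dif_neg fun h => ha (Finset.mem_sdiff.1 h).1
  · exact dif_neg fun h => (Finset.mem_sdiff.1 h).2 ha
  · beta_reduce
    by_cases ha' : a ∈ F (i - 1)
    · rw [dif_neg fun h => (Finset.mem_sdiff.1 h).2 ha', mul_zero]
      refine Finset.sum_eq_zero fun b _ => ?_
      by_cases hb : b ∈ σ.toFun a
      · rw [dif_neg fun h => (Finset.mem_sdiff.1 h).2 (hσ.closed' (by omega) a ha' b hb), mul_zero]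
      · rw [σ.incidence_eq_zero_of_notMem hb, zero_mul]
    · have hmem : a ∈ F i \ F (i - 1) := Finset.mem_sdiff.2 ⟨ha, ha'⟩
      rw [dif_pos hmem, ← Finset.sum_subset (Finset.subset_univ (F i \ F (i - 1)))]
      · have h1 : ∑ b, σ.diagBlock F i ⟨a, hmem⟩ b * x b = θ * x ⟨a, hmem⟩ :=
          congrFun hQx ⟨a, hmem⟩
        rw [← h1, ← Finset.sum_coe_sort (F i \ F (i - 1))]
        exact Finset.sum_congr rfl fun b _ => by rw [dif_pos b.2]; rfl
      · intro b _ hb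
        rw [dif_neg hb, mul_zero]

/-- Every word over level `i` occurs behind every word that starts at level `i`. -/
theorem eventually_aux_incidence_pow_pos (hσ : σ.IsOfPrimitiveComponents n F) {i : ℕ}
    (hi : 1 ≤ i) (hin : i ≤ n) {m : ℕ} (hm : 1 ≤ m) :
    ∃ K, 1 ≤ K ∧ ∀ k, K ≤ k → ∀ u v : σ.lang (F i) m, σ.firstLetter hm u ∉ F (i - 1) →
      0 < ((σ.aux (F i) m hm).incidence ^ k) u v := by
  obtain ⟨K, hK, h⟩ := hσ.eventually_mem_iter
  choose r hr using fun v : σ.lang (F i) m => v.2.2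
  refine ⟨K + ∑ v, r v, by omega, fun k hk u v hu => ?_⟩
  obtain ⟨-, a, ha, hva⟩ := hr v
  have hrv : r v ≤ ∑ v, r v := Finset.single_le_sum (fun _ _ => Nat.zero_le _) (Finset.mem_univ v)
  have hmem := h (k - r v) (by omega) i hi hin _
    (σ.firstLetter_mem (hσ.closed i hi hin) hm u) hu a ha
  have hinf : v.1 <:+: σ.onWord^[k] (u.1.take 1) := by
    have h1 := σ.onWord_iterate_infix (r v)
      (List.singleton_infix_iff a _ |>.2 hmem)
    rw [iter, ← Function.iterate_add_apply, Nat.add_sub_cancel' (by omega)] at h1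
    rw [σ.take_one_eq_head hm]
    exact hva.trans h1
  obtain ⟨s, t, hst⟩ := hinf
  have hW : σ.onWord^[k] u.1 = s ++ (v.1 ++ (t ++ σ.onWord^[k] (u.1.drop 1))) := by
    conv_lhs => rw [← List.take_append_drop 1 u.1, onWord_iterate_append, ← hst]
    simp
  rw [aux_incidence_pow_apply, Nat.cast_pos, windowCount]
  refine Finset.sum_pos' (fun _ _ => Nat.zero_le _) ⟨s.length, ?_, ?_⟩
  · have := v.2.1
    rw [Finset.mem_range, ← hst]
    simp only [List.length_append]
    omega
  · rw [hW, List.drop_left, List.take_left' v.2.1, if_pos rfl]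
    exact one_pos

/-- If `θ_i > 1`, then `σ^k(a)` contains more than `m` letters of level `i`, and one of them is
followed by `m` letters. -/
theorem exists_firstLetter_notMem (hσ : σ.IsOfPrimitiveComponents n F) {i : ℕ}
    (hi : 1 ≤ i) (hin : i ≤ n) {m : ℕ} (hm : 1 ≤ m) (hθ : 1 < σ.theta F i) :
    ∃ u : σ.lang (F i) m, σ.firstLetter hm u ∉ F (i - 1) := by
  obtain ⟨hθ0, z, hz, hz1, hz2, hMz⟩ := hσ.exists_eigenvector hi hin
  obtain ⟨a, ha, ha'⟩ : ∃ a ∈ F i, a ∉ F (i - 1) := by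
    have hss := hσ.ssubset (i - 1) (by omega)
    rw [Nat.sub_add_cancel hi] at hss
    exact Finset.exists_of_ssubset hss
  have hz0 : ∀ a, 0 ≤ z a := fun a => by
    by_cases h1 : a ∈ F i
    · by_cases h2 : a ∈ F (i - 1)
      · exact (hz2 a h2).ge
      · exact (hz a h1 h2).le
    · exact (hz1 a h1).ge
  have hpow : ∀ k, ∀ a ∈ F i, ∑ b, (σ.incidence ^ k) a b * z b = σ.theta F i ^ k * z a := by
    intro k
    induction k with
    | zero => intro a _; simp [Matrix.one_apply]
    | succ k ih =>
      intro a ha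
      have h1 : (σ.incidence ^ (k + 1)).mulVec z a =
          ∑ c, σ.incidence a c * ((σ.incidence ^ k).mulVec z c) := by
        rw [pow_succ', ← Matrix.mulVec_mulVec]
        rfl
      have h2 : ∀ c, σ.incidence a c * ((σ.incidence ^ k).mulVec z c) =
          σ.theta F i ^ k * (σ.incidence a c * z c) := by
        intro c
        by_cases hc : c ∈ σ.toFun a
        · have h3 : (σ.incidence ^ k).mulVec z c = σ.theta F i ^ k * z c :=
            ih c (hσ.closed i hi hin a ha c hc)
          rw [h3]
          ring
        · rw [σ.incidence_eq_zero_of_notMem hc]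
          ring
      change (σ.incidence ^ (k + 1)).mulVec z a = _
      rw [h1, Finset.sum_congr rfl fun c _ => h2 c, ← Finset.mul_sum, hMz a ha]
      ring
  set p : A → Bool := fun b => decide (b ∈ F i ∧ b ∉ F (i - 1)) with hp
  have hcount : ∀ k, σ.theta F i ^ k * z a ≤ ((σ.iter k a).countP p : ℝ) * ∑ b, z b := by
    intro k
    rw [← hpow k a ha, Finset.mul_sum]
    refine Finset.sum_le_sum fun b _ => ?_
    by_cases hb : b ∈ F i ∧ b ∉ F (i - 1)
    · rw [incidence_pow_apply]
      refine mul_le_mul_of_nonneg_right (Nat.cast_le.2 ?_) (hz0 b)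
      refine List.countP_mono_left fun x _ hx => ?_
      rw [beq_iff_eq] at hx
      rw [hx]
      exact decide_eq_true hb
    · have : z b = 0 := by
        by_cases h1 : b ∈ F i
        · exact hz2 b (by_contra fun h2 => hb ⟨h1, h2⟩)
        · exact hz1 b h1
      rw [this, mul_zero, mul_zero]
  obtain ⟨k, hk, hkm⟩ : ∃ k, 1 ≤ k ∧ m < (σ.iter k a).countP p := by
    have hS : 0 < ∑ b, z b := Finset.sum_pos' (fun b _ => hz0 b) ⟨a, Finset.mem_univ a, hz a ha ha'⟩
    have htend := (tendsto_pow_atTop_atTop_of_one_lt hθ).atTop_mul_const (hz a ha ha')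
    obtain ⟨k, hk1, hk2⟩ := ((htend.eventually_gt_atTop (m * ∑ b, z b)).and
      (eventually_ge_atTop 1)).exists
    refine ⟨k, hk2, ?_⟩
    have := lt_of_mul_lt_mul_right (hk1.trans_le (hcount k)) hS.le
    exact_mod_cast this
  set W := σ.iter k a with hW
  have hlen : m < W.length := hkm.trans_le List.countP_le_length
  have hpos : 0 < (W.take (W.length - m)).countP p := by
    have h1 : (W.take (W.length - m)).countP p + (W.drop (W.length - m)).countP p =
        W.countP p := by
      rw [← List.countP_append, List.take_append_drop]
    have h2 : (W.drop (W.length - m)).countP p ≤ (W.drop (W.length - m)).length :=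
      List.countP_le_length
    rw [List.length_drop] at h2
    omega
  obtain ⟨b, hb, hpb⟩ := List.countP_pos_iff.1 hpos
  obtain ⟨q, hq, rfl⟩ := List.getElem_of_mem hb
  rw [List.length_take] at hq
  refine ⟨⟨(W.drop q).take m, ?_, k, hk, a, ha,
    (List.take_prefix _ _).isInfix.trans (List.drop_suffix _ _).isInfix⟩, ?_⟩
  · rw [List.length_take, List.length_drop]
    omega
  · rw [List.getElem_take] at hpb
    simp only [firstLetter, List.head_take, List.head_drop]
    exact (of_decide_eq_true hpb).2

end IsOfPrimitiveComponents

end Substitution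

/-! ### Growth of the powers of the auxiliary matrices -/

theorem Matrix.pow_apply_mul_pow_apply_le {ι : Type*} [Fintype ι] [DecidableEq ι]
    {N : Matrix ι ι ℝ} (hN : ∀ u v, 0 ≤ N u v) (k l : ℕ) (u w v : ι) :
    (N ^ k) u w * (N ^ l) w v ≤ (N ^ (k + l)) u v := by
  rw [pow_add, mul_apply]
  exact Finset.single_le_sum (f := fun w => (N ^ k) u w * (N ^ l) w v)
    (fun w _ => mul_nonneg (pow_apply_nonneg hN k u w) (pow_apply_nonneg hN l w v))
    (Finset.mem_univ w)

namespace Substitution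

variable {A : Type*} {σ : Substitution A}

theorem lang_mono {B B' : Finset A} (h : B ⊆ B') {m : ℕ} {w : List A} (hw : w ∈ σ.lang B m) :
    w ∈ σ.lang B' m := by
  obtain ⟨hlen, k, hk, a, ha, hinf⟩ := hw
  exact ⟨hlen, k, hk, a, h ha, hinf⟩

theorem lang_empty (m : ℕ) : σ.lang ∅ m = ∅ := by
  ext w
  simp [lang]

namespace IsOfPrimitiveComponents

variable [Fintype A] [DecidableEq A] {n : ℕ} {F : ℕ → Finset A}

/-- The block of the words that start at level `i` is primitive, and the Perron–Frobenius
eigenvector of `Q_i`, evaluated at the first letters, is an eigenvector for it. -/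
theorem exists_tendsto_pow_top (hσ : σ.IsOfPrimitiveComponents n F) {i : ℕ} (hi : 1 ≤ i)
    (hin : i ≤ n) {m : ℕ} (hm : 1 ≤ m) (hθ : 1 < σ.theta F i) :
    ∃ x y : σ.lang (F i) m → ℝ,
      (σ.aux (F i) m hm).incidence.mulVec x = σ.theta F i • x ∧
      (∀ u, σ.firstLetter hm u ∈ F (i - 1) → x u = 0) ∧
      (∀ u, σ.firstLetter hm u ∉ F (i - 1) → 0 < x u) ∧
      (∀ u, σ.firstLetter hm u ∉ F (i - 1) → 0 < y u) ∧
      y ⬝ᵥ x = 1 ∧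
      ∀ u v, σ.firstLetter hm u ∉ F (i - 1) → σ.firstLetter hm v ∉ F (i - 1) →
        Tendsto (fun k : ℕ => (σ.theta F i ^ k)⁻¹ * ((σ.aux (F i) m hm).incidence ^ k) u v)
          atTop (𝓝 (x u * y v)) := by
  obtain ⟨hθ0, z, hz, -, hz2, hMz⟩ := hσ.exists_eigenvector hi hin
  obtain ⟨u₀, hu₀⟩ := hσ.exists_firstLetter_notMem hi hin hm hθ
  obtain ⟨K, hK1, hK⟩ := hσ.eventually_aux_incidence_pow_pos hi hin hm
  set N := (σ.aux (F i) m hm).incidence with hN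
  have hN0 : ∀ u v, 0 ≤ N u v := incidence_nonneg _
  have hmem : ∀ u : σ.lang (F i) m, σ.firstLetter hm u ∈ F i := fun u =>
    σ.firstLetter_mem (hσ.closed i hi hin) hm u
  set x : σ.lang (F i) m → ℝ := fun u => z (σ.firstLetter hm u) with hx
  have hNx : N.mulVec x = σ.theta F i • x := by
    ext u
    exact (σ.sum_aux_incidence_mul_head hm u z).trans (hMz _ (hmem u))
  have hx0 : ∀ u, σ.firstLetter hm u ∈ F (i - 1) → x u = 0 := fun u hu => hz2 _ hu
  have hxpos : ∀ u, σ.firstLetter hm u ∉ F (i - 1) → 0 < x u := fun u hu => hz _ (hmem u) hu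
  set P : σ.lang (F i) m → Prop := fun u => σ.firstLetter hm u ∉ F (i - 1) with hP
  set Q : Matrix {u // P u} {u // P u} ℝ := N.submatrix Subtype.val Subtype.val with hQ
  have hQpow : ∀ k, Q ^ k = (N ^ k).submatrix Subtype.val Subtype.val :=
    Matrix.submatrix_val_pow fun u w v _ hw hv k => by
      rw [hN, σ.aux_incidence_eq_zero hm (hσ.closed' (by omega)) (not_not.1 hw) hv, mul_zero]
  have hQprim : Q.IsPrimitive := by
    refine ⟨fun u v => hN0 _ _, K, hK1, fun u v => ?_⟩
    rw [hQpow]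
    exact hK K le_rfl u.1 v.1 u.2
  have hQx : Q.mulVec (fun u => x u.1) = σ.theta F i • fun u => x u.1 := by
    ext u
    have h1 : ∑ v, N u.1 v * x v = σ.theta F i * x u.1 := congrFun hNx u.1
    change ∑ v : {u // P u}, N u.1 v.1 * x v.1 = σ.theta F i * x u.1
    rw [← h1, ← Finset.sum_filter_add_sum_filter_not Finset.univ P,
      Finset.sum_eq_zero (s := Finset.univ.filter fun w => ¬P w), add_zero]
    · exact (Finset.sum_subtype _ (fun w => by simp) (fun w => N u.1 w * x w)).symm
    · intro w hw
      rw [hx0 w (not_not.1 (Finset.mem_filter.1 hw).2), mul_zero]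
  have : Nonempty {u // P u} := ⟨⟨u₀, hu₀⟩⟩
  obtain ⟨y, hy, hyx, hlim⟩ := hQprim.tendsto_pow hθ0 (fun u => hxpos u.1 u.2) hQx
  refine ⟨x, fun u => if h : P u then y ⟨u, h⟩ else 0, hNx, hx0, hxpos, fun u hu => ?_, ?_,
    fun u v hu hv => ?_⟩
  · have hPu : P u := hu
    simp only [dif_pos hPu]
    exact hy _
  · rw [← hyx, dotProduct, dotProduct, ← Finset.sum_filter_add_sum_filter_not Finset.univ P,
      Finset.sum_eq_zero (s := Finset.univ.filter fun w => ¬P w), add_zero,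
      Finset.sum_subtype (p := P) _ (fun w => by simp)]
    · exact Finset.sum_congr rfl fun u _ => by rw [dif_pos u.2]
    · intro w hw
      rw [dif_neg (Finset.mem_filter.1 hw).2, zero_mul]
  · have hPu : P u := hu
    have hPv : P v := hv
    simp only [dif_pos hPv]
    refine (hlim ⟨u, hPu⟩ ⟨v, hPv⟩).congr fun k => ?_
    rw [hQpow, Matrix.submatrix_apply]

open Classical in
/-- If the levels between `s` and `j` have dominant eigenvalues below `θ`, then the windows in
`σ^k(u)` that do not belong to `L_m` of level `s` grow strictly slower than `θ ^ k`, for all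
words `u` starting at level at most `j`. Level by level, their number `T_k(a)`, for `u_1 = a`,
satisfies `T_{k+1}(a) ≤ ∑_b (Q_j)_{ab} T_k(b) + O(μ ^ k)`. -/
theorem exists_sum_pow_le_geometric (hσ : σ.IsOfPrimitiveComponents n F) {i : ℕ} (hin : i ≤ n)
    {m : ℕ} (hm : 1 ≤ m) {θ : ℝ} (hθ : 1 < θ) {s j : ℕ} (hsj : s ≤ j) (hji : j ≤ i)
    (hlt : ∀ l, s < l → l ≤ j → σ.theta F l < θ) :
    ∃ C μ : ℝ, 0 ≤ C ∧ 1 ≤ μ ∧ μ < θ ∧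
      ∀ u : σ.lang (F i) m, σ.firstLetter hm u ∈ F j → ∀ k : ℕ,
        (((σ.aux (F i) m hm).incidence ^ k).mulVec
          fun v => if v.1 ∈ σ.lang (F s) m then 0 else 1) u ≤ C * μ ^ k := by
  set N := (σ.aux (F i) m hm).incidence with hN
  have hN0 : ∀ u v, 0 ≤ N u v := incidence_nonneg _
  set d : σ.lang (F i) m → ℝ := fun v => if v.1 ∈ σ.lang (F s) m then 0 else 1 with hd
  induction j, hsj using Nat.le_induction with
  | base =>
    refine ⟨m, 1, Nat.cast_nonneg m, le_rfl, hθ, fun u hu k => ?_⟩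
    rw [one_pow, mul_one]
    exact σ.sum_aux_incidence_pow_le hm u hu k
  | succ j hsj ih =>
    obtain ⟨C, μ, hC, hμ1, hμθ, hbound⟩ := ih (by omega) fun l h1 h2 => hlt l h1 (by omega)
    obtain ⟨hη0, z, hz, hz1, hz2, hMz⟩ := hσ.exists_eigenvector (i := j + 1) (by omega) (by omega)
    rw [Nat.add_sub_cancel] at hz hz2
    have hηθ := hlt (j + 1) (by omega) le_rfl
    set η := σ.theta F (j + 1) with hη
    have hz0 : ∀ a, 0 ≤ z a := fun a => by
      by_cases h1 : a ∈ F (j + 1)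
      · by_cases h2 : a ∈ F j
        · exact (hz2 a h2).ge
        · exact (hz a h1 h2).le
      · exact (hz1 a h1).ge
    obtain ⟨ν, hν1, hνθ⟩ := exists_between (max_lt hμθ hηθ)
    have hμν : μ < ν := (le_max_left _ _).trans_lt hν1
    have hην : η < ν := (le_max_right _ _).trans_lt hν1
    have hν0 : 0 < ν := by linarith
    obtain ⟨ε, hε, hεz⟩ : ∃ ε > 0, ∀ a ∈ F (j + 1), a ∉ F j → ε ≤ z a := by
      obtain ⟨ε, hε, h⟩ := Matrix.exists_pos_forall_le_of_finite
        (f := fun a : {a // a ∈ F (j + 1) ∧ a ∉ F j} => z a.1) fun a => hz a.1 a.2.1 a.2.2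
      exact ⟨ε, hε, fun a h1 h2 => h ⟨a, h1, h2⟩⟩
    set R : ℝ := ∑ a, ∑ b, σ.incidence a b with hR
    have hRa : ∀ a, ∑ b, σ.incidence a b ≤ R := fun a =>
      Finset.single_le_sum (f := fun a => ∑ b, σ.incidence a b)
        (fun a _ => Finset.sum_nonneg fun b _ => σ.incidence_nonneg a b) (Finset.mem_univ a)
    have hR0 : 0 ≤ R :=
      Finset.sum_nonneg fun a _ => Finset.sum_nonneg fun b _ => σ.incidence_nonneg a b
    -- `D` is chosen so that `D ν ^ k z` dominates the recursion at level `j + 1`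
    set D : ℝ := m / ε + C * R / ((ν - η) * ε) with hD
    have hνη : 0 < ν - η := sub_pos.2 hην
    have hD0 : 0 ≤ D := by positivity
    have hDm : m ≤ D * ε := by
      have h1 : D * ε = m + C * R / (ν - η) := by
        rw [hD]
        field_simp
      have h2 : 0 ≤ C * R / (ν - η) := by positivity
      linarith
    have hDR : C * R ≤ D * ((ν - η) * ε) := by
      have h1 : D * ((ν - η) * ε) = m * (ν - η) + C * R := by
        rw [hD]
        field_simp
      have h2 : 0 ≤ m * (ν - η) := by positivity
      linarith
    have key : ∀ k, ∀ u : σ.lang (F i) m, σ.firstLetter hm u ∈ F (j + 1) →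
        ((N ^ k).mulVec d) u ≤ C * μ ^ k + D * ν ^ k * z (σ.firstLetter hm u) ∧
        (σ.firstLetter hm u ∉ F j →
          ((N ^ k).mulVec d) u ≤ D * ν ^ k * z (σ.firstLetter hm u)) := by
      intro k
      have hfirst : ∀ k, ∀ u : σ.lang (F i) m, σ.firstLetter hm u ∈ F (j + 1) →
          (σ.firstLetter hm u ∉ F j →
            ((N ^ k).mulVec d) u ≤ D * ν ^ k * z (σ.firstLetter hm u)) →
          ((N ^ k).mulVec d) u ≤ C * μ ^ k + D * ν ^ k * z (σ.firstLetter hm u) := by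
        intro k u hu h
        have h1 : 0 ≤ D * ν ^ k * z (σ.firstLetter hm u) :=
          mul_nonneg (by positivity) (hz0 _)
        have h2 : 0 ≤ C * μ ^ k := by positivity
        by_cases hj : σ.firstLetter hm u ∈ F j
        · have := hbound u hj k
          linarith
        · have := h hj
          linarith
      suffices h : ∀ u : σ.lang (F i) m, σ.firstLetter hm u ∈ F (j + 1) →
          σ.firstLetter hm u ∉ F j →
            ((N ^ k).mulVec d) u ≤ D * ν ^ k * z (σ.firstLetter hm u) from
        fun u hu => ⟨hfirst k u hu (h u hu), h u hu⟩
      induction k with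
      | zero =>
        intro u hu hj
        have h1 : d u ≤ 1 := by
          simp only [hd]
          split_ifs <;> norm_num
        have h2 : D * ε ≤ D * z (σ.firstLetter hm u) :=
          mul_le_mul_of_nonneg_left (hεz _ hu hj) hD0
        have h3 : (1 : ℝ) ≤ m := by exact_mod_cast hm
        rw [pow_zero, Matrix.one_mulVec, pow_zero, mul_one]
        linarith
      | succ k ihk =>
        intro u hu hj
        have h1 : ((N ^ (k + 1)).mulVec d) u = ∑ w, N u w * ((N ^ k).mulVec d) w := by
          rw [pow_succ', ← Matrix.mulVec_mulVec]
          rfl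
        have h2 : ∀ w, N u w * ((N ^ k).mulVec d) w ≤
            N u w * (C * μ ^ k + D * ν ^ k * z (σ.firstLetter hm w)) := by
          intro w
          by_cases hw : σ.firstLetter hm w ∈ F (j + 1)
          · exact mul_le_mul_of_nonneg_left (hfirst k w hw (ihk w hw)) (hN0 u w)
          · rw [hN, σ.aux_incidence_eq_zero hm (hσ.closed' (by omega)) hu hw, zero_mul, zero_mul]
        have h3 : ∑ w, N u w * (C * μ ^ k + D * ν ^ k * z (σ.firstLetter hm w)) =
            C * μ ^ k * ∑ b, σ.incidence (σ.firstLetter hm u) b +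
              D * ν ^ k * (η * z (σ.firstLetter hm u)) := by
          rw [hN, σ.sum_aux_incidence_mul_head hm u fun b => C * μ ^ k + D * ν ^ k * z b,
            ← hMz _ hu, Finset.mul_sum, Finset.mul_sum, ← Finset.sum_add_distrib]
          exact Finset.sum_congr rfl fun b _ => by ring
        have h4 : C * μ ^ k * ∑ b, σ.incidence (σ.firstLetter hm u) b ≤ C * ν ^ k * R := by
          refine mul_le_mul (mul_le_mul_of_nonneg_left ?_ hC) (hRa _)
            (Finset.sum_nonneg fun b _ => σ.incidence_nonneg _ b) (by positivity)
          exact pow_le_pow_left₀ (by linarith) hμν.le k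
        have h5 : C * R ≤ D * ((ν - η) * z (σ.firstLetter hm u)) :=
          hDR.trans (mul_le_mul_of_nonneg_left
            (mul_le_mul_of_nonneg_left (hεz _ hu hj) hνη.le) hD0)
        have h6 := mul_le_mul_of_nonneg_right h5 (pow_pos hν0 k).le
        rw [h1]
        refine (Finset.sum_le_sum fun w _ => h2 w).trans ?_
        rw [h3, pow_succ]
        nlinarith
    refine ⟨C + D * ∑ a, z a, ν, ?_, by linarith, hνθ, fun u hu k => ?_⟩
    · have := Finset.sum_nonneg fun a (_ : a ∈ Finset.univ) => hz0 a
      positivity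
    · have h1 : z (σ.firstLetter hm u) ≤ ∑ a, z a :=
        Finset.single_le_sum (fun a _ => hz0 a) (Finset.mem_univ _)
      have h2 : μ ^ k ≤ ν ^ k := pow_le_pow_left₀ (by linarith) hμν.le k
      have h3 : 0 < ν ^ k := pow_pos hν0 k
      calc ((N ^ k).mulVec d) u ≤ C * μ ^ k + D * ν ^ k * z (σ.firstLetter hm u) :=
            (key k u hu).1
        _ ≤ C * ν ^ k + D * ν ^ k * ∑ a, z a :=
            add_le_add (mul_le_mul_of_nonneg_left h2 hC)
              (mul_le_mul_of_nonneg_left h1 (by positivity))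
        _ = _ := by ring

/-- The limits of the entries `(u, v)` with `u` starting at level `i` and `v` outside level `s`,
when the levels strictly between `s` and `i` have dominant eigenvalues below `θ_i`. -/
theorem exists_tendsto_pow (hσ : σ.IsOfPrimitiveComponents n F) {i : ℕ} (hi : 1 ≤ i)
    (hin : i ≤ n) {m : ℕ} (hm : 1 ≤ m) (hθ : 1 < σ.theta F i) {s : ℕ} (hs : s < i)
    (hlt : ∀ l, s < l → l < i → σ.theta F l < σ.theta F i) :
    ∃ α β : σ.lang (F i) m → ℝ,
      (σ.aux (F i) m hm).incidence.mulVec α = σ.theta F i • α ∧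
      (∀ u, σ.firstLetter hm u ∈ F (i - 1) → α u = 0) ∧
      (∀ u, σ.firstLetter hm u ∉ F (i - 1) → 0 < α u) ∧
      β ⬝ᵥ α = 1 ∧
      (∀ v : σ.lang (F i) m, v.1 ∉ σ.lang (F s) m → 0 < β v) ∧
      ∀ u v : σ.lang (F i) m, σ.firstLetter hm u ∉ F (i - 1) → v.1 ∉ σ.lang (F s) m →
        Tendsto (fun k : ℕ => (σ.theta F i ^ k)⁻¹ * ((σ.aux (F i) m hm).incidence ^ k) u v)
          atTop (𝓝 (α u * β v)) := by
  classical
  obtain ⟨x, y, hNx, hx0, hxpos, hypos, hyx, hlim⟩ := hσ.exists_tendsto_pow_top hi hin hm hθ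
  obtain ⟨C, μ, hC, hμ1, hμθ, hbound⟩ := hσ.exists_sum_pow_le_geometric hin hm hθ (s := s)
    (j := i - 1) (by omega) (by omega) fun l h1 h2 => hlt l h1 (by omega)
  obtain ⟨u₀, hu₀⟩ := hσ.exists_firstLetter_notMem hi hin hm hθ
  obtain ⟨K, hK1, hK⟩ := hσ.eventually_aux_incidence_pow_pos hi hin hm
  set N := (σ.aux (F i) m hm).incidence with hN
  have hN0 : ∀ u v, 0 ≤ N u v := incidence_nonneg _
  have hθ0 : 0 < σ.theta F i := by linarith
  have hex : ∀ v : σ.lang (F i) m, ∃ b : ℝ, (σ.firstLetter hm v ∉ F (i - 1) → b = y v) ∧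
      (v.1 ∉ σ.lang (F s) m → ∀ u, σ.firstLetter hm u ∉ F (i - 1) →
        Tendsto (fun k : ℕ => (σ.theta F i ^ k)⁻¹ * (N ^ k) u v) atTop (𝓝 (x u * b))) := by
    intro v
    by_cases hv : σ.firstLetter hm v ∉ F (i - 1)
    · exact ⟨y v, fun _ => rfl, fun _ u hu => hlim u v hu hv⟩
    · by_cases hvs : v.1 ∈ σ.lang (F s) m
      · exact ⟨0, fun h => absurd h hv, fun h => absurd hvs h⟩
      · obtain ⟨b, hb⟩ := Matrix.exists_tendsto_pow_of_exit
          (P := fun u => σ.firstLetter hm u ∉ F (i - 1)) hN0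
          (fun u v hu hv => σ.aux_incidence_eq_zero hm (hσ.closed' (by omega)) (not_not.1 hu) hv)
          hθ0 hlim hv (C := C) (zero_le_one.trans hμ1) hμθ fun e he l => by
            refine le_trans ?_ (hbound e (not_not.1 he) l)
            have h1 := Finset.single_le_sum (f := fun w => (N ^ l) e w *
              if w.1 ∈ σ.lang (F s) m then (0 : ℝ) else 1) (fun w _ =>
              mul_nonneg (Matrix.pow_apply_nonneg hN0 l e w) (by split_ifs <;> norm_num))
              (Finset.mem_univ v)
            simp only [if_neg hvs, mul_one] at h1
            exact h1
        exact ⟨b, fun h => absurd h hv, fun _ => hb⟩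
  choose β hβy hβ using hex
  refine ⟨x, β, hNx, hx0, hxpos, ?_, fun v hv => ?_, fun u v hu hv => hβ v hv u hu⟩
  · rw [← hyx]
    refine Finset.sum_congr rfl fun v _ => ?_
    by_cases hv : σ.firstLetter hm v ∈ F (i - 1)
    · rw [hx0 v hv, mul_zero, mul_zero]
    · rw [hβy v hv]
  · -- a path from `u₀` to itself of length `k`, followed by one of length `K` to `v`
    have h1 : Tendsto (fun k : ℕ => (σ.theta F i ^ k)⁻¹ * (N ^ k) u₀ u₀ *
        ((σ.theta F i ^ K)⁻¹ * (N ^ K) u₀ v)) atTop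
        (𝓝 (x u₀ * y u₀ * ((σ.theta F i ^ K)⁻¹ * (N ^ K) u₀ v))) :=
      (hlim u₀ u₀ hu₀ hu₀).mul_const _
    have h2 := (hβ v hv u₀ hu₀).comp (tendsto_add_atTop_nat K)
    have h3 := le_of_tendsto_of_tendsto' h1 h2 fun k => by
      have h4 := Matrix.pow_apply_mul_pow_apply_le hN0 k K u₀ u₀ v
      have h5 : 0 ≤ (σ.theta F i ^ (k + K))⁻¹ := inv_nonneg.2 (pow_nonneg hθ0.le _)
      calc _ = (σ.theta F i ^ (k + K))⁻¹ * ((N ^ k) u₀ u₀ * (N ^ K) u₀ v) := by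
            rw [pow_add, mul_inv]
            ring
        _ ≤ _ := mul_le_mul_of_nonneg_left h4 h5
    have h6 : 0 < x u₀ * y u₀ * ((σ.theta F i ^ K)⁻¹ * (N ^ K) u₀ v) :=
      mul_pos (mul_pos (hxpos u₀ hu₀) (hypos u₀ hu₀))
        (mul_pos (inv_pos.2 (pow_pos hθ0 K)) (hK K le_rfl u₀ v hu₀))
    exact pos_of_mul_pos_right (h6.trans_le h3) (hxpos u₀ hu₀).le

/-- The entries behind a word that starts at level `s` grow at least like `θ_s ^ k`. -/
theorem exists_le_pow_apply (hσ : σ.IsOfPrimitiveComponents n F) {s : ℕ} (hs : 1 ≤ s)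
    (hsn : s ≤ n) {m : ℕ} (hm : 1 ≤ m) (hθ : 1 < σ.theta F s) :
    ∃ w : σ.lang (F s) m, ∀ v, ∃ b > 0, ∀ᶠ k : ℕ in atTop,
      b * σ.theta F s ^ k ≤ ((σ.aux (F s) m hm).incidence ^ k) w v := by
  obtain ⟨x, y, -, -, hxpos, hypos, -, hlim⟩ := hσ.exists_tendsto_pow_top hs hsn hm hθ
  obtain ⟨w, hw⟩ := hσ.exists_firstLetter_notMem hs hsn hm hθ
  obtain ⟨K, -, hK⟩ := hσ.eventually_aux_incidence_pow_pos hs hsn hm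
  have hN0 : ∀ u v, 0 ≤ (σ.aux (F s) m hm).incidence u v := incidence_nonneg _
  have hθ0 : 0 < σ.theta F s := by linarith
  have hxy : 0 < x w * y w := mul_pos (hxpos w hw) (hypos w hw)
  refine ⟨w, fun v => ⟨x w * y w / 2 * ((σ.aux (F s) m hm).incidence ^ K) w v /
    σ.theta F s ^ K, ?_, ?_⟩⟩
  · have := hK K le_rfl w v hw
    positivity
  · obtain ⟨J, hJ⟩ := eventually_atTop.1
      ((hlim w w hw hw).eventually_const_le (half_lt_self hxy))
    filter_upwards [eventually_ge_atTop (J + K)] with k hk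
    obtain ⟨l, rfl⟩ : ∃ l, k = l + K := ⟨k - K, by omega⟩
    have h1 := hJ l (by omega)
    rw [inv_mul_eq_div, le_div_iff₀ (pow_pos hθ0 l)] at h1
    refine le_trans (le_of_eq ?_) ((mul_le_mul_of_nonneg_right h1 (hK K le_rfl w v hw).le).trans
      (Matrix.pow_apply_mul_pow_apply_le hN0 l K w w v))
    rw [pow_add]
    have := (pow_pos hθ0 K).ne'
    field_simp

/-- If `θ_s ≥ θ_i` for a lower level `s`, then the entries that lead from level `i` to a word of
`L_m` of level `s` outgrow `θ_i ^ k`, even when `θ_s = θ_i`. -/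
theorem tendsto_atTop_pow (hσ : σ.IsOfPrimitiveComponents n F) {i : ℕ}
    (hin : i ≤ n) {m : ℕ} (hm : 1 ≤ m) (hθ : 1 < σ.theta F i) {s : ℕ} (hs : 1 ≤ s) (hsi : s < i)
    (hle : σ.theta F i ≤ σ.theta F s) {u v : σ.lang (F i) m}
    (hu : σ.firstLetter hm u ∉ F (i - 1)) (hv : v.1 ∈ σ.lang (F s) m) :
    Tendsto (fun k : ℕ => (σ.theta F i ^ k)⁻¹ * ((σ.aux (F i) m hm).incidence ^ k) u v)
      atTop atTop := by
  have hi : 1 ≤ i := by omega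
  have hθ0 : 0 < σ.theta F i := by linarith
  obtain ⟨w, hw⟩ := hσ.exists_le_pow_apply hs (by omega) hm (hθ.trans_le hle)
  obtain ⟨b, hb, hbw⟩ := hw ⟨v.1, hv⟩
  obtain ⟨x, y, -, -, hxpos, hypos, -, hlim⟩ := hσ.exists_tendsto_pow_top hi hin hm hθ
  obtain ⟨K, -, hK⟩ := hσ.eventually_aux_incidence_pow_pos hi hin hm
  set N := (σ.aux (F i) m hm).incidence with hN
  have hN0 : ∀ u v, 0 ≤ N u v := incidence_nonneg _
  have hlow : ∀ w : σ.lang (F i) m, w.1 ∈ σ.lang (F s) m → σ.firstLetter hm w ∈ F (i - 1) :=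
    fun w hw => hσ.mono (show s ≤ i - 1 by omega) (by omega)
      (σ.mem_of_mem_lang (hσ.closed s hs (by omega)) hw (List.head_mem _))
  set w' : σ.lang (F i) m := ⟨w.1, lang_mono (hσ.mono hsi.le hin) w.2⟩ with hw'
  have hPclosed : ∀ u v : σ.lang (F i) m, ¬(σ.firstLetter hm u ∉ F (i - 1)) →
      σ.firstLetter hm v ∉ F (i - 1) → N u v = 0 := fun u v hu hv =>
    σ.aux_incidence_eq_zero hm (hσ.closed' (by omega)) (not_not.1 hu) hv
  -- the edge along which a path from `u` to `w` leaves the words starting at level `i`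
  have hpos := hK K le_rfl u w' hu
  rw [Matrix.pow_apply_eq_sum_exitWeight (P := fun u => σ.firstLetter hm u ∉ F (i - 1)) hPclosed hu
    (not_not.2 (hlow w' w.2))] at hpos
  obtain ⟨l, -, hl⟩ := Finset.exists_ne_zero_of_sum_ne_zero hpos.ne'
  obtain ⟨c, hc, hcl⟩ := Finset.exists_ne_zero_of_sum_ne_zero hl
  obtain ⟨e, he, hel⟩ := Finset.exists_ne_zero_of_sum_ne_zero (right_ne_zero_of_mul hcl)
  have hc' := (Finset.mem_filter.1 hc).2
  have hce : 0 < N c e := lt_of_le_of_ne (hN0 c e) (left_ne_zero_of_mul hel).symm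
  have hew : 0 < (N ^ l) e w' :=
    lt_of_le_of_ne (Matrix.pow_apply_nonneg hN0 l e w') (right_ne_zero_of_mul hel).symm
  refine Matrix.tendsto_atTop_pow_of_exit (P := fun u => σ.firstLetter hm u ∉ F (i - 1))
    (b := (N ^ l) e w' * b / σ.theta F i ^ l) hN0 hPclosed hθ0 hu hc' (Finset.mem_filter.1 he).2
    (not_not.2 (hlow v hv)) hce (mul_pos (hxpos u hu) (hypos c hc')) (hlim u c hu hc')
    (by positivity) ?_
  obtain ⟨J, hJ⟩ := eventually_atTop.1 hbw
  filter_upwards [eventually_ge_atTop (l + J)] with k hk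
  obtain ⟨j, rfl⟩ : ∃ j, k = l + j := ⟨k - l, by omega⟩
  have h1 := hJ j (by omega)
  have h2 : ((σ.aux (F s) m hm).incidence ^ j) w ⟨v.1, hv⟩ = (N ^ j) w' v := by
    rw [hN, aux_incidence_pow_apply, aux_incidence_pow_apply]
  rw [h2] at h1
  have h3 : b * σ.theta F i ^ j ≤ (N ^ j) w' v :=
    (mul_le_mul_of_nonneg_left (pow_le_pow_left₀ hθ0.le hle j) hb.le).trans h1
  refine le_trans (le_of_eq ?_) ((mul_le_mul_of_nonneg_left h3 hew.le).trans
    (Matrix.pow_apply_mul_pow_apply_le hN0 l j e w' v))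
  rw [pow_add]
  have := (pow_pos hθ0 l).ne'
  field_simp

end IsOfPrimitiveComponents

/-! ### The comparison of `θ_i` with the eigenvalues of the lower levels -/

variable {F : ℕ → Finset A}

theorem mem_bWords_iff {i : ℕ} (hi : 1 ≤ i) {m : ℕ} (hm : 1 ≤ m) (u : σ.lang (F i) m) :
    u.1 ∈ σ.bWords F m (i - 1) ↔ σ.firstLetter hm u ∈ F (i - 1) := by
  have hhead : u.1.head? = some (σ.firstLetter hm u) := List.head?_eq_some_head _
  constructor
  · rintro ⟨-, a, ha, h⟩
    rw [hhead] at h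
    exact Option.some.inj h ▸ ha
  · intro h
    refine ⟨?_, _, h, hhead⟩
    rw [Nat.sub_add_cancel hi]
    exact u.2

variable [DecidableEq A]

theorem theta_le_lam {i j : ℕ} (hj : 1 ≤ j) (hji : j ≤ i) : σ.theta F j ≤ σ.lam F i :=
  le_csSup ((Set.finite_Icc 1 i).image _).bddAbove ⟨j, ⟨hj, hji⟩, rfl⟩

theorem exists_theta_ge_of_le_lam {i : ℕ} (hθ : 0 < σ.theta F i)
    (h : σ.theta F i ≤ σ.lam F (i - 1)) : ∃ j, 1 ≤ j ∧ j < i ∧ σ.theta F i ≤ σ.theta F j := by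
  have hne : (σ.theta F '' Set.Icc 1 (i - 1)).Nonempty := by
    by_contra hempty
    rw [lam, Set.not_nonempty_iff_eq_empty.1 hempty, Real.sSup_empty] at h
    linarith
  obtain ⟨j, ⟨hj1, hj2⟩, hj⟩ := hne.csSup_mem ((Set.finite_Icc 1 (i - 1)).image _)
  exact ⟨j, hj1, by omega, h.trans_eq hj.symm⟩

/-- `i' - 1` is the highest level below `i` whose eigenvalue is at least `θ_i`. -/
theorem iPrime_sub_one_spec {i : ℕ} (hθ : 0 < σ.theta F i)
    (h : σ.theta F i ≤ σ.lam F (i - 1)) :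
    1 ≤ σ.iPrime F i - 1 ∧ σ.iPrime F i - 1 < i ∧
      σ.theta F i ≤ σ.theta F (σ.iPrime F i - 1) ∧
      ∀ l, σ.iPrime F i - 1 < l → l < i → σ.theta F l < σ.theta F i := by
  obtain ⟨j, hj1, hji, hj⟩ := exists_theta_ge_of_le_lam hθ h
  rw [iPrime]
  split_ifs with hI
  · refine ⟨by omega, by omega, ?_, fun l h1 h2 => by omega⟩
    by_contra hlt
    have hmem : i - 1 ∈ σ.indexSet F i := by
      refine ⟨by omega, by omega, fun l h1 h2 => ?_⟩
      rw [show l = i - 1 by omega]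
      exact not_le.1 hlt
    rw [hI] at hmem
    exact hmem
  · obtain ⟨h1, h2, h3⟩ := Nat.sInf_mem (Set.nonempty_iff_ne_empty.2 hI)
    set t := sInf (σ.indexSet F i) with ht
    have hjt : j < t := by
      by_contra hlt
      exact (h3 j (not_lt.1 hlt) hji).not_ge hj
    refine ⟨by omega, by omega, ?_, fun l h4 h5 => h3 l (by omega) h5⟩
    by_contra hlt
    have hmem : t - 1 ∈ σ.indexSet F i := by
      refine ⟨by omega, by omega, fun l h4 h5 => ?_⟩
      rcases Nat.eq_or_lt_of_le h4 with rfl | h6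
      · exact not_le.1 hlt
      · exact h3 l (by omega) h5
    have := Nat.sInf_le hmem
    omega

end Substitution

theorem lemma4p3 {A : Type*} [Fintype A] [DecidableEq A] (σ : Substitution A) (n : ℕ)
    (F : ℕ → Finset A) (hσ : σ.IsOfPrimitiveComponents n F)
    (i : ℕ) (hi : 1 ≤ i) (hin : i ≤ n) (m : ℕ) (hm : 1 ≤ m) (hθ : 1 < σ.theta F i) :
    (σ.lam F (i - 1) < σ.theta F i →
      ∃ α β : σ.lang (F i) m → ℝ,
        (σ.aux (F i) m hm).incidence.mulVec α = σ.theta F i • α ∧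
        Matrix.vecMul β (σ.aux (F i) m hm).incidence = σ.theta F i • β ∧
        β ⬝ᵥ α = 1 ∧
        (∀ u : σ.lang (F i) m, u.1 ∈ σ.bWords F m (i - 1) → α u = 0) ∧
        (∀ u : σ.lang (F i) m, u.1 ∉ σ.bWords F m (i - 1) → 0 < α u) ∧
        (∀ v : σ.lang (F i) m, 0 < β v) ∧
        ∀ u v : σ.lang (F i) m, u.1 ∉ σ.bWords F m (i - 1) →
          Tendsto (fun k : ℕ => (σ.theta F i ^ k)⁻¹ *
            ((σ.aux Finset.univ m hm).incidence ^ k) (σ.incl u) (σ.incl v))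
            atTop (𝓝 (α u * β v)) ∧ 0 < α u * β v) ∧
    (σ.theta F i ≤ σ.lam F (i - 1) →
      ∃ γ δ : σ.lang (F i) m → ℝ,
        (∀ u : σ.lang (F i) m, u.1 ∉ σ.bWords F m (i - 1) → 0 < γ u) ∧
        (∀ v : σ.lang (F i) m, v.1 ∉ σ.lang (F (σ.iPrime F i - 1)) m → 0 < δ v) ∧
        ∀ u v : σ.lang (F i) m, u.1 ∉ σ.bWords F m (i - 1) →
          (v.1 ∈ σ.lang (F (σ.iPrime F i - 1)) m →
            Tendsto (fun k : ℕ => (σ.theta F i ^ k)⁻¹ *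
              ((σ.aux Finset.univ m hm).incidence ^ k) (σ.incl u) (σ.incl v))
              atTop atTop) ∧
          (v.1 ∉ σ.lang (F (σ.iPrime F i - 1)) m →
            Tendsto (fun k : ℕ => (σ.theta F i ^ k)⁻¹ *
              ((σ.aux Finset.univ m hm).incidence ^ k) (σ.incl u) (σ.incl v))
              atTop (𝓝 (γ u * δ v)))) := by
  constructor
  · intro hlam
    have hF0 : σ.lang (F 0) m = ∅ := by rw [hσ.zero, Substitution.lang_empty]
    obtain ⟨α, β, hα, hα0, hαpos, hβα, hβpos, hlim⟩ := hσ.exists_tendsto_pow hi hin hm hθ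
      (s := 0) (by omega) fun l h1 h2 =>
        (Substitution.theta_le_lam (show 1 ≤ l by omega) (by omega)).trans_lt hlam
    rw [hF0] at hβpos hlim
    refine ⟨α, β, hα, ?_, hβα,
      fun u hu => hα0 u ((Substitution.mem_bWords_iff hi hm u).1 hu),
      fun u hu => hαpos u fun h => hu ((Substitution.mem_bWords_iff hi hm u).2 h),
      fun v => hβpos v (Set.notMem_empty _), fun u v hu => ?_⟩
    · -- `β` is, up to a factor, a row of the limit of `θ_i ^ (-k) N ^ k`
      obtain ⟨u, hu⟩ := hσ.exists_firstLetter_notMem hi hin hm hθ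
      ext v
      have hθ0 : σ.theta F i ≠ 0 := by linarith
      have h1 : Tendsto (fun k : ℕ => ∑ w, (σ.theta F i ^ k)⁻¹ *
          ((σ.aux (F i) m hm).incidence ^ k) u w * (σ.aux (F i) m hm).incidence w v) atTop
          (𝓝 (∑ w, α u * β w * (σ.aux (F i) m hm).incidence w v)) :=
        tendsto_finsetSum _ fun w _ => (hlim u w hu (Set.notMem_empty _)).mul_const _
      have h2 := ((hlim u v hu (Set.notMem_empty _)).comp (tendsto_add_atTop_nat 1)).const_mul
        (σ.theta F i)
      have h3 := tendsto_nhds_unique h1 (h2.congr fun k => by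
        simp only [Function.comp]
        rw [pow_succ, pow_succ, Matrix.mul_apply, mul_inv, mul_comm (σ.theta F i ^ k)⁻¹,
          ← mul_assoc, ← mul_assoc, mul_inv_cancel₀ hθ0, one_mul, Finset.mul_sum]
        exact Finset.sum_congr rfl fun w _ => (mul_assoc _ _ _).symm)
      simp only [mul_assoc] at h3
      rw [← Finset.mul_sum, mul_left_comm] at h3
      exact mul_left_cancel₀ (hαpos u hu).ne' h3
    · have hu' : σ.firstLetter hm u ∉ F (i - 1) := fun h =>
        hu ((Substitution.mem_bWords_iff hi hm u).2 h)
      refine ⟨?_, mul_pos (hαpos u hu') (hβpos v (Set.notMem_empty _))⟩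
      simp only [Substitution.aux_incidence_pow_incl]
      exact hlim u v hu' (Set.notMem_empty _)
  · intro hlam
    obtain ⟨hs1, hsi, hle, hlt⟩ := Substitution.iPrime_sub_one_spec (by linarith) hlam
    obtain ⟨α, β, -, -, hαpos, -, hβpos, hlim⟩ := hσ.exists_tendsto_pow hi hin hm hθ hsi hlt
    refine ⟨α, β, fun u hu => hαpos u fun h => hu ((Substitution.mem_bWords_iff hi hm u).2 h),
      hβpos, fun u v hu => ?_⟩
    have hu' : σ.firstLetter hm u ∉ F (i - 1) := fun h =>
      hu ((Substitution.mem_bWords_iff hi hm u).2 h)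
    simp only [Substitution.aux_incidence_pow_incl]
    exact ⟨fun hv => hσ.tendsto_atTop_pow hin hm hθ hs1 hsi hle hu' hv,
      fun hv => hlim u v hu' hv⟩
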